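/- Let $\ell,m,n$ be positive integers, and for $i\ge 1$ let $\hat\imath\in\{1,\dots,\ell\}$ be the residue with $\hat\imath\equiv i\pmod \ell$. Let $F_{\ell,m,n}$ be the CNF formula over the variables $x_i$ ($1\le i\le m\ell-1$) and $w_{j,k}$ ($1\le j\le \ell$, $1\le k\le n$) that consists of - $w_{j,k}\lor\overline{w_{j,k+1}}$ and $\overline{w_{j,k}}\lor w_{j,k+1}$ for $1\le j\le\ell$, $1\le k\le n-1$; - $w_{\hat\imath,1}\lor w_{\hat\imath,n}\lor\overline{x_{i-1}}\lor x_i$ and $\overline{w_{\hat\imath,1}}\lor\overline{w_{\hat\imath,n}}\lor\overline{x_{i-1}}\lor x_i$ for $1\le i\le m\ell$, where $x_0=1$ and $x_{m\ell}=0$ are constants, so that $\overline{x_0}$ and $x_{m\ell}$ are omitted. The formula $F^{(1)}_{\ell,m,n}$ has additional variables $y_j,z_j$ and, for each $1\le j\le\ell$, the four additional clauses $$\overline{w_{j,1}}\lor w_{j,2}\lor\overline{z_j},\qquad \overline{w_{j,2}}\lor z_j,\qquad w_{j,1}\lor\overline{w_{j,2}}\lor\overline{y_j},\qquad w_{j,2}\lor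 y_j .$$ Clauses are finite sets of literals. Resolving $A\lor x$ with $B\lor\overline{x}$ on the pivot $x$ gives $A\lor B$; the resolvent is a *merge* if $A$ and $B$ share a literal. An *input derivation* from a set of clauses (axioms) starts from an axiom and repeatedly resolves the current clause with an axiom; it is written as the sequence of its clauses, each side premise directly before its resolvent. It is *strongly regular* if, for each resolution step, the pivot variable does not occur in the resolvent or in any later clause of this sequence. An *RMA derivation* from $F$ is a sequence of input derivations, each from the clauses of $F$ together with the last clauses of the preceding derivations of the sequence, in which every derivation but the last contains a merge. It is an *LRMA derivation* if moreover each derivation of the sequence is strongly regular. It is a *refutation* if its last clause is the empty clause. Its *length* is the total number of clauses in its input derivations. **Proposition.** Let $G_n=F^{(1)}_{\ell,n,n}$ with $\ell=48\lceil\log_2 n\rceil$. Then $G_n$ has $O(n\log n)$ variables and $O(n\log n)$ clauses, $G_n$ has an RMA refutation of length $O(n\log n)$, and every LRMA refutation of $G_n$ has length $\Omega(n^2\log n)$ (as $n\to\infty$). -/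

import Mathlib

/-! ### Clauses, CNF formulas and resolution -/

/-- A literal over the variable type `V`: `(x, true)` is `x` and `(x, false)` is its negation. -/
abbrev Literal (V : Type) := V × Bool

/-- A clause is a finite set (disjunction) of literals; `∅` is the empty clause `⊥`. -/
abbrev Clause (V : Type) := Finset (Literal V)

/-- A CNF formula is a finite set (conjunction) of clauses. -/
abbrev CNF (V : Type) := Finset (Clause V)

section Resolution

variable {V : Type} [DecidableEq V]

/-- The support of a clause: the set of variables it contains. -/
def Clause.vars (C : Clause V) : Finset V := Finset.image Prod.fst C

/-- The set of variables occurring in a formula. -/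
def CNF.vars (F : CNF V) : Finset V := F.biUnion Clause.vars

/-- One step of an input derivation: the current clause, which has to contain the literal
`(pivot, sign)`, is resolved with the clause `side`, which has to contain the opposite literal. -/
structure InputStep (V : Type) where
  side : Clause V
  pivot : V
  sign : Bool

/-- The current clause without the pivot literal. -/
def InputStep.mainRest (s : InputStep V) (C : Clause V) : Clause V :=
  Finset.erase C (s.pivot, s.sign)

/-- The side premise without the pivot literal. -/
def InputStep.sideRest (s : InputStep V) : Clause V :=
  Finset.erase s.side (s.pivot, !s.sign)

/-- The step is a legal application of the resolution rule to `C` and `s.side`. -/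
def InputStep.Applies (s : InputStep V) (C : Clause V) : Prop :=
  (s.pivot, s.sign) ∈ C ∧ (s.pivot, !s.sign) ∈ s.side

/-- The resolvent. -/
def InputStep.resolvent (s : InputStep V) (C : Clause V) : Clause V :=
  s.mainRest C ∪ s.sideRest

/-- The resolvent is a merge: besides the pivot, the premises share a literal. -/
def InputStep.IsMerge (s : InputStep V) (C : Clause V) : Prop :=
  (s.mainRest C ∩ s.sideRest).Nonempty

/-- A (candidate) input derivation: an initial clause, which is then successively resolved with
side premises. -/
structure InputDerivation (V : Type) where
  start : Clause V
  steps : List (InputStep V)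

namespace InputDerivation

/-- Every step, starting from the current clause `C`, is a resolution step whose side premise
is one of the clauses in `Ax`. -/
def StepsValid (Ax : Set (Clause V)) : Clause V → List (InputStep V) → Prop
  | _, [] => True
  | C, s :: ss => s.side ∈ Ax ∧ s.Applies C ∧ StepsValid Ax (s.resolvent C) ss

/-- The sequence of clauses of the derivation: the initial clause, followed, for every step, by
the side premise and the resolvent. -/
def stepsClauses : Clause V → List (InputStep V) → List (Clause V)
  | C, [] => [C]
  | C, s :: ss => C :: s.side :: stepsClauses (s.resolvent C) ss

/-- The last clause. -/
def stepsConclusion : Clause V → List (InputStep V) → Clause V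
  | C, [] => C
  | C, s :: ss => stepsConclusion (s.resolvent C) ss

/-- Some step produces a merge. -/
def StepsMerge : Clause V → List (InputStep V) → Prop
  | _, [] => False
  | C, s :: ss => s.IsMerge C ∨ StepsMerge (s.resolvent C) ss

/-- For every step, the pivot variable occurs neither in the resolvent of this step nor in any
later clause of the sequence (side premises included). -/
def StepsRegular : Clause V → List (InputStep V) → Prop
  | _, [] => True
  | C, s :: ss =>
      (∀ E ∈ stepsClauses (s.resolvent C) ss, s.pivot ∉ Clause.vars E) ∧
        StepsRegular (s.resolvent C) ss

/-- `d` is an input resolution derivation from the axioms `Ax`. -/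
def IsFrom (d : InputDerivation V) (Ax : Set (Clause V)) : Prop :=
  d.start ∈ Ax ∧ StepsValid Ax d.start d.steps

/-- The clauses of the derivation, in order. -/
def clauses (d : InputDerivation V) : List (Clause V) := stepsClauses d.start d.steps

/-- The length of a derivation is the number of clauses in the sequence. -/
def length (d : InputDerivation V) : ℕ := d.clauses.length

/-- The last clause of the derivation. -/
def conclusion (d : InputDerivation V) : Clause V := stepsConclusion d.start d.steps

/-- The derivation contains a merge. -/
def ContainsMerge (d : InputDerivation V) : Prop := StepsMerge d.start d.steps

/-- The derivation is strongly regular. -/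
def StronglyRegular (d : InputDerivation V) : Prop := StepsRegular d.start d.steps

end InputDerivation

/-- An input-structured sequence of input derivations: the last clause of each derivation may be
used as an axiom in the successive ones. -/
def InputStructured : Set (Clause V) → List (InputDerivation V) → Prop
  | _, [] => True
  | Ax, d :: ds => d.IsFrom Ax ∧ InputStructured (insert d.conclusion Ax) ds

/-- The total number of clauses in a sequence of derivations. -/
def sequenceLength (π : List (InputDerivation V)) : ℕ :=
  (π.map InputDerivation.length).sum

/-- The last clause of the sequence is the empty clause. -/
def EndsInEmptyClause (π : List (InputDerivation V)) : Prop :=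
  ∃ d ∈ π.getLast?, d.conclusion = ∅

/-- An RMA derivation (resolution with merge ancestors) from `F`: an input-structured sequence of
input derivations in which all derivations but the last contain a merge. -/
def IsRMA (F : CNF V) (π : List (InputDerivation V)) : Prop :=
  InputStructured (↑F : Set (Clause V)) π ∧ ∀ d ∈ π.dropLast, d.ContainsMerge

/-- An LRMA derivation: an RMA derivation that is locally regular, that is, every derivation in
the sequence is strongly regular. -/
def IsLRMA (F : CNF V) (π : List (InputDerivation V)) : Prop :=
  IsRMA F π ∧ ∀ d ∈ π, d.StronglyRegular

def IsRMARefutation (F : CNF V) (π : List (InputDerivation V)) : Prop :=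
  IsRMA F π ∧ EndsInEmptyClause π

def IsLRMARefutation (F : CNF V) (π : List (InputDerivation V)) : Prop :=
  IsLRMA F π ∧ EndsInEmptyClause π

end Resolution

/-! ### The separating formula -/

/-- The variables `x_i`, `w_{j,k}`, `y_j`, `z_j`; all indices start at `1`. -/
inductive SepVar where
  | x (i : ℕ)
  | w (j k : ℕ)
  | y (j : ℕ)
  | z (j : ℕ)
  deriving DecidableEq

namespace SepFormula

open SepVar

/-- `B_{j,k,1} = w_{j,k} ∨ ¬w_{j,k+1}` and `B_{j,k,0} = ¬w_{j,k} ∨ w_{j,k+1}`. -/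
def clauseB (j k : ℕ) (b : Bool) : Clause SepVar := {(w j k, b), (w j (k + 1), !b)}

/-- The representative of `i` modulo `ℓ` in `{1, …, ℓ}` (for `i ≥ 1`). -/
def blockOf (ℓ i : ℕ) : ℕ := (i - 1) % ℓ + 1

/-- The clause `¬x_{i-1} ∨ x_i`, where `x_0 = 1` and `x_{mℓ} = 0` are constants. -/
def clauseX (ℓ m i : ℕ) : Clause SepVar :=
  (if i = 1 then ∅ else {(x (i - 1), false)}) ∪ (if i = m * ℓ then ∅ else {(x i, true)})

/-- `A_{i,1} = w_{î,1} ∨ w_{î,n} ∨ ¬x_{i-1} ∨ x_i` and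
`A_{i,0} = ¬w_{î,1} ∨ ¬w_{î,n} ∨ ¬x_{i-1} ∨ x_i`. -/
def clauseA (ℓ m n i : ℕ) (b : Bool) : Clause SepVar :=
  {(w (blockOf ℓ i) 1, b), (w (blockOf ℓ i) n, b)} ∪ clauseX ℓ m i

/-- The formula `F_{ℓ,m,n}`: the clauses `B_{j,k,b}` for `j ∈ [ℓ]`, `k ∈ [n-1]` and the clauses
`A_{i,b}` for `i ∈ [mℓ]`. -/
def F (ℓ m n : ℕ) : CNF SepVar :=
  ((Finset.Icc 1 ℓ).biUnion fun j => (Finset.Ico 1 n).biUnion fun k =>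
      {clauseB j k true, clauseB j k false}) ∪
    (Finset.Icc 1 (m * ℓ)).biUnion fun i => {clauseA ℓ m n i true, clauseA ℓ m n i false}

/-- The four extra clauses of block `j`. -/
def extra (j : ℕ) : CNF SepVar :=
  { {(w j 1, false), (w j 2, true), (z j, false)},
    {(w j 2, false), (z j, true)},
    {(w j 1, true), (w j 2, false), (y j, false)},
    {(w j 2, true), (y j, true)} }

/-- The formula `F⁽¹⁾_{ℓ,m,n}`. -/
def F₁ (ℓ m n : ℕ) : CNF SepVar := F ℓ m n ∪ (Finset.Icc 1 ℓ).biUnion extra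

/-- The family with parameters `ℓ = 48 log₂ n` (the logarithm rounded up) and `m = n`. -/
def family (n : ℕ) : CNF SepVar := F₁ (48 * Nat.clog 2 n) n n

end SepFormula

/-! Upper bound. Inside block `j`, `derivationW` derives the two implications between `w j 1` and `w
j n`. An auxiliary variable makes the merge possible: resolve `w j 2` away, then bring it back
together with a second copy of the literal of `w j 1`. This costs `O(n)` per block, once. With these
lemmas every pair `clauseA` yields the implication `clauseX` in constantly many steps, and a chain
of the `clauseX` ends in the empty clause.

Lower bound. Bringing `w j 2` back is what strong regularity forbids. A non-tautological strongly
regular derivation that uses only axioms of one block contains no merge (`not_isMerge`), so its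
conclusion cannot be made a lemma; tautologies never help. Hence every useful clause descends from
some `clauseA`. These clauses are the nodes; each records the `clauseB` freshly used for it, and
`totalUse` is bounded by the length of the refutation (`exists_nodes`).

If there are fewer than `8 ^ q` nodes, with `48 * q` blocks, a greedy restriction `γ` of at most `14
* q` blocks satisfies every node clause touching at least `28 * q` blocks. Fix one of the `m`
intervals of `ℓ` consecutive positions and take the earliest node whose clause, disregarding
unassigned blocks, is false throughout the interval. At least `6 * q` unassigned blocks `j` do not
occur in it. For such `j` and `2 ≤ s < n`, the assignment that cuts block `j` between `s` and `s +
1` falsifies no axiom except some `clauseB j s _`. Tracing falsified clauses backwards therefore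
reaches a node that uses it and that, by minimality, is false at the position of `j` but not on the
whole interval (`exists_covers`). The positions at which the `x`-literals of a clause are false are
convex, so for fixed `j` a node does this for at most two intervals. Counting triples of interval,
`j` and `s` gives `m * (6 * q * (n - 2)) ≤ 2 * totalUse L` (`le_totalUse`). -/

open InputDerivation

/-! ### General facts on input derivations -/

section General

variable {V : Type} [DecidableEq V]

theorem stepsValid_mono {Ax Ax' : Set (Clause V)} (h : Ax ⊆ Ax') :
    ∀ (ss : List (InputStep V)) (C : Clause V), StepsValid Ax C ss → StepsValid Ax' C ss
  | [], _, _ => trivial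
  | _ :: ss, _, ⟨h₁, h₂, h₃⟩ => ⟨h h₁, h₂, stepsValid_mono h ss _ h₃⟩

theorem isFrom_mono {Ax Ax' : Set (Clause V)} (h : Ax ⊆ Ax') {d : InputDerivation V}
    (hd : d.IsFrom Ax) : d.IsFrom Ax' :=
  ⟨h hd.1, stepsValid_mono h _ _ hd.2⟩

theorem stepsConclusion_append (ss' : List (InputStep V)) :
    ∀ (ss : List (InputStep V)) (C : Clause V),
      stepsConclusion C (ss ++ ss') = stepsConclusion (stepsConclusion C ss) ss'
  | [], _ => rfl
  | _ :: ss, _ => stepsConclusion_append ss' ss _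

theorem stepsValid_append {Ax : Set (Clause V)} (ss' : List (InputStep V)) :
    ∀ (ss : List (InputStep V)) (C : Clause V), StepsValid Ax C ss →
      StepsValid Ax (stepsConclusion C ss) ss' → StepsValid Ax C (ss ++ ss')
  | [], _, _, h => h
  | _ :: ss, _, ⟨h₁, h₂, h₃⟩, h => ⟨h₁, h₂, stepsValid_append ss' ss _ h₃ h⟩

theorem length_stepsClauses :
    ∀ (ss : List (InputStep V)) (C : Clause V), (stepsClauses C ss).length = 2 * ss.length + 1
  | [], _ => rfl
  | _ :: ss, _ => by
      simp only [stepsClauses, List.length_cons, length_stepsClauses ss]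
      ring

theorem length_eq (d : InputDerivation V) : d.length = 2 * d.steps.length + 1 :=
  length_stepsClauses _ _

theorem inputStructured_of_forall :
    ∀ (π : List (InputDerivation V)) (Ax : Set (Clause V)), (∀ d ∈ π, d.IsFrom Ax) →
      InputStructured Ax π
  | [], _, _ => trivial
  | d :: π, Ax, h => ⟨h d (by simp), inputStructured_of_forall π _ fun e he =>
      isFrom_mono (Set.subset_insert _ _) (h e (by simp [he]))⟩

theorem inputStructured_mono :
    ∀ (π : List (InputDerivation V)) {Ax Ax' : Set (Clause V)}, Ax ⊆ Ax' →
      InputStructured Ax π → InputStructured Ax' π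
  | [], _, _, _, _ => trivial
  | _ :: π, _, _, h, ⟨h₁, h₂⟩ => ⟨isFrom_mono h h₁,
      inputStructured_mono π (Set.insert_subset_insert h) h₂⟩

theorem inputStructured_append (π' : List (InputDerivation V)) :
    ∀ (π : List (InputDerivation V)) (Ax : Set (Clause V)), InputStructured Ax π →
      InputStructured (Ax ∪ {C | ∃ d ∈ π, d.conclusion = C}) π' → InputStructured Ax (π ++ π')
  | [], Ax, _, h => by simpa using h
  | d :: π, Ax, ⟨h₁, h₂⟩, h => by
      refine ⟨h₁, inputStructured_append π' π _ h₂ (inputStructured_mono π' ?_ h)⟩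
      rintro C (hC | ⟨e, he, rfl⟩)
      · exact Or.inl (Set.mem_insert_of_mem _ hC)
      · rcases List.mem_cons.1 he with rfl | he
        · exact Or.inl (Set.mem_insert _ _)
        · exact Or.inr ⟨e, he, rfl⟩

end General

/-! ### The short refutation -/

namespace SepFormula

open SepVar

theorem clauseB_mem_F₁ {ℓ m n j k : ℕ} (hj : j ∈ Finset.Icc 1 ℓ) (hk : k ∈ Finset.Ico 1 n)
    (b : Bool) : clauseB j k b ∈ F₁ ℓ m n := by
  refine Finset.mem_union_left _ (Finset.mem_union_left _ ?_)
  refine Finset.mem_biUnion.2 ⟨j, hj, Finset.mem_biUnion.2 ⟨k, hk, ?_⟩⟩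
  cases b <;> simp

theorem clauseA_mem_F₁ {ℓ m n i : ℕ} (hi : i ∈ Finset.Icc 1 (m * ℓ)) (b : Bool) :
    clauseA ℓ m n i b ∈ F₁ ℓ m n := by
  refine Finset.mem_union_left _ (Finset.mem_union_right _ ?_)
  refine Finset.mem_biUnion.2 ⟨i, hi, ?_⟩
  cases b <;> simp

theorem extra_subset_F₁ {ℓ m n j : ℕ} (hj : j ∈ Finset.Icc 1 ℓ) : extra j ⊆ F₁ ℓ m n :=
  fun _ hC => Finset.mem_union_right _ (Finset.mem_biUnion.2 ⟨j, hj, hC⟩)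

theorem blockOf_mem {ℓ : ℕ} (hℓ : 0 < ℓ) (i : ℕ) : blockOf ℓ i ∈ Finset.Icc 1 ℓ := by
  have := Nat.mod_lt (i - 1) hℓ
  simp only [blockOf, Finset.mem_Icc]
  omega

/-- The auxiliary variable of block `j` whose clauses allow a merge on `(w j 1, b)`. -/
def auxVar (j : ℕ) (b : Bool) : SepVar := if b then y j else z j

/-- The clause `(w j 1, b) ∨ (w j k, !b)`. -/
def clauseW (j k : ℕ) (b : Bool) : Clause SepVar := {(w j 1, b), (w j k, !b)}

/-- The steps extending `clauseW j k b` to `clauseW j (k + p) b`. -/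
def chainSteps (j : ℕ) (b : Bool) : ℕ → ℕ → List (InputStep SepVar)
  | _, 0 => []
  | k, p + 1 => ⟨clauseB j k b, w j k, !b⟩ :: chainSteps j b (k + 1) p

theorem length_chainSteps (j : ℕ) (b : Bool) :
    ∀ p k, (chainSteps j b k p).length = p
  | 0, _ => rfl
  | p + 1, k => by simp [chainSteps, length_chainSteps j b p]

theorem resolvent_chain {j k : ℕ} (b : Bool) :
    InputStep.resolvent ⟨clauseB j k b, w j k, !b⟩ (clauseW j k b) = clauseW j (k + 1) b := by
  ext ⟨v, c⟩
  simp only [InputStep.resolvent, InputStep.mainRest, InputStep.sideRest, clauseB, clauseW,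
    Finset.mem_union, Finset.mem_erase, Finset.mem_insert, Finset.mem_singleton]
  constructor
  · rintro (⟨h, h' | h'⟩ | ⟨h, h' | h'⟩) <;> simp_all
  · rintro (h | h)
    · left; simp only [Prod.mk.injEq] at h; obtain ⟨rfl, rfl⟩ := h
      exact ⟨by simp, Or.inl rfl⟩
    · right; simp only [Prod.mk.injEq] at h; obtain ⟨rfl, rfl⟩ := h
      simp

theorem chainSteps_valid {Ax : Set (Clause SepVar)} {j : ℕ} (b : Bool) :
    ∀ p k, 2 ≤ k → (∀ k', k ≤ k' → k' < k + p → clauseB j k' b ∈ Ax) →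
      StepsValid Ax (clauseW j k b) (chainSteps j b k p) ∧
        stepsConclusion (clauseW j k b) (chainSteps j b k p) = clauseW j (k + p) b
  | 0, _, _, _ => ⟨trivial, rfl⟩
  | p + 1, k, hk, h => by
      have ih := chainSteps_valid (Ax := Ax) (j := j) b p (k + 1) (by omega)
        fun k' h₁ h₂ => h k' (by omega) (by omega)
      refine ⟨⟨h k le_rfl (by omega), ⟨?_, ?_⟩, ?_⟩, ?_⟩
      · simp [clauseW]
      · simp [clauseB]
      · simp only [resolvent_chain b]; exact ih.1
      · simp only [chainSteps, stepsConclusion, resolvent_chain b]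
        rw [ih.2]; congr 1; ring

/-- The derivation of `clauseW j n b`. -/
def derivationW (n j : ℕ) (b : Bool) : InputDerivation SepVar where
  start := clauseB j 1 b
  -- The second step reintroduces `w j 2`, the pivot of the first. It yields the merge on `(w j 1,
  -- b)` and destroys strong regularity.
  steps := ⟨{(w j 2, b), (auxVar j b, true)}, w j 2, !b⟩ ::
    ⟨{(w j 1, b), (w j 2, !b), (auxVar j b, false)}, auxVar j b, true⟩ ::
    chainSteps j b 2 (n - 2)

theorem derivationW_resolvent₁ (j : ℕ) (b : Bool) :
    InputStep.resolvent ⟨{(w j 2, b), (auxVar j b, true)}, w j 2, !b⟩ (clauseB j 1 b) =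
      {(w j 1, b), (auxVar j b, true)} := by
  ext ⟨v, c⟩
  cases b <;>
  simp only [InputStep.resolvent, InputStep.mainRest, InputStep.sideRest, clauseB, auxVar,
    Finset.mem_union, Finset.mem_erase, Finset.mem_insert, Finset.mem_singleton] <;>
  constructor <;> intro h <;> simp_all <;> grind

theorem derivationW_resolvent₂ (j : ℕ) (b : Bool) :
    InputStep.resolvent ⟨{(w j 1, b), (w j 2, !b), (auxVar j b, false)}, auxVar j b, true⟩
      {(w j 1, b), (auxVar j b, true)} = clauseW j 2 b := by
  ext ⟨v, c⟩
  cases b <;>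
  simp only [InputStep.resolvent, InputStep.mainRest, InputStep.sideRest, clauseW, auxVar,
    Finset.mem_union, Finset.mem_erase, Finset.mem_insert, Finset.mem_singleton] <;>
  constructor <;> intro h <;> simp_all <;> grind

theorem derivationW_spec {ℓ m n j : ℕ} (hn : 2 ≤ n) (hj : j ∈ Finset.Icc 1 ℓ) (b : Bool) :
    (derivationW n j b).IsFrom (F₁ ℓ m n : Set (Clause SepVar)) ∧
      (derivationW n j b).conclusion = clauseW j n b ∧ (derivationW n j b).ContainsMerge ∧
      (derivationW n j b).length = 2 * n + 1 := by
  have hc := chainSteps_valid (Ax := (F₁ ℓ m n : Set (Clause SepVar))) (j := j) b (n - 2) 2 le_rfl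
    fun k h₁ h₂ => clauseB_mem_F₁ hj (Finset.mem_Ico.2 ⟨by omega, by omega⟩) b
  have hs : (derivationW n j b).start = clauseB j 1 b := rfl
  refine ⟨⟨clauseB_mem_F₁ hj (Finset.mem_Ico.2 ⟨le_rfl, by omega⟩) b,
    extra_subset_F₁ hj ?_, ⟨?_, ?_⟩, extra_subset_F₁ hj ?_, ⟨?_, ?_⟩, ?_⟩, ?_, ?_, ?_⟩
  · cases b <;> simp [extra, auxVar]
  · simp [derivationW, clauseB]
  · simp
  · cases b <;> simp [extra, auxVar]
  · rw [hs, derivationW_resolvent₁]; simp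
  · simp
  · rw [hs, derivationW_resolvent₁, derivationW_resolvent₂]; exact hc.1
  · simp only [derivationW, conclusion, stepsConclusion]
    rw [derivationW_resolvent₁, derivationW_resolvent₂, hc.2]
    congr 1; omega
  · refine Or.inr (Or.inl ⟨(w j 1, b), ?_⟩)
    rw [hs, derivationW_resolvent₁]
    cases b <;> simp [InputStep.mainRest, InputStep.sideRest, auxVar]
  · rw [length_eq]
    simp only [derivationW, List.length_cons, length_chainSteps]
    omega

theorem mem_clauseX {ℓ m i : ℕ} {v : SepVar} {c : Bool} (h : (v, c) ∈ clauseX ℓ m i) :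
    ∃ k, v = x k := by
  unfold clauseX at h
  split_ifs at h <;> simp at h <;> grind

theorem w_notMem_clauseX {ℓ m i j k : ℕ} {c : Bool} : (w j k, c) ∉ clauseX ℓ m i := fun h => by
  obtain ⟨_, h⟩ := mem_clauseX h
  cases h

/-- The derivation of `(w î 1, false) ∨ clauseX i`. -/
def derivationN (ℓ m n i : ℕ) : InputDerivation SepVar where
  start := clauseA ℓ m n i false
  steps := [⟨clauseW (blockOf ℓ i) n false, w (blockOf ℓ i) n, false⟩]

/-- The derivation of `clauseX i`. -/
def derivationX (ℓ m n i : ℕ) : InputDerivation SepVar where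
  start := clauseA ℓ m n i true
  steps := [⟨clauseW (blockOf ℓ i) n true, w (blockOf ℓ i) n, true⟩,
    ⟨insert (w (blockOf ℓ i) 1, false) (clauseX ℓ m i), w (blockOf ℓ i) 1, true⟩]

theorem resolvent_clauseA {ℓ m n i : ℕ} (hn : 2 ≤ n) (b : Bool) :
    InputStep.resolvent ⟨clauseW (blockOf ℓ i) n b, w (blockOf ℓ i) n, b⟩ (clauseA ℓ m n i b) =
      insert (w (blockOf ℓ i) 1, b) (clauseX ℓ m i) := by
  have h1 : n ≠ 1 := by omega
  have h2 : 1 ≠ n := by omega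
  have h3 : ∀ c, (w (blockOf ℓ i) n, c) ∉ clauseX ℓ m i := fun c => w_notMem_clauseX
  ext ⟨v, c⟩
  simp only [InputStep.resolvent, InputStep.mainRest, InputStep.sideRest, clauseA, clauseW,
    Finset.mem_union, Finset.mem_erase, Finset.mem_insert, Finset.mem_singleton]
  constructor
  · rintro (⟨h, (h' | h') | h'⟩ | ⟨h, h' | h'⟩) <;> simp_all
  · rintro (h | h)
    · simp_all
    · exact Or.inl ⟨fun h' => h3 b (h' ▸ h), Or.inr h⟩

theorem isMerge_clauseA {ℓ m n i : ℕ} (hn : 2 ≤ n) (b : Bool) :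
    InputStep.IsMerge ⟨clauseW (blockOf ℓ i) n b, w (blockOf ℓ i) n, b⟩ (clauseA ℓ m n i b) := by
  refine ⟨(w (blockOf ℓ i) 1, b), ?_⟩
  have h2 : 1 ≠ n := by omega
  simp [InputStep.mainRest, InputStep.sideRest, clauseA, clauseW, h2]

theorem derivationN_spec {ℓ m n i : ℕ} {Ax : Set (Clause SepVar)} (hn : 2 ≤ n)
    (hA : clauseA ℓ m n i false ∈ Ax) (hW : clauseW (blockOf ℓ i) n false ∈ Ax) :
    (derivationN ℓ m n i).IsFrom Ax ∧
      (derivationN ℓ m n i).conclusion = insert (w (blockOf ℓ i) 1, false) (clauseX ℓ m i) ∧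
      (derivationN ℓ m n i).ContainsMerge ∧ (derivationN ℓ m n i).length = 3 := by
  refine ⟨⟨hA, hW, ⟨?_, ?_⟩, trivial⟩, resolvent_clauseA hn false,
    Or.inl (isMerge_clauseA hn false), rfl⟩
  · simp [derivationN, clauseA]
  · simp [clauseW]

theorem derivationX_spec {ℓ m n i : ℕ} {Ax : Set (Clause SepVar)} (hn : 2 ≤ n)
    (hA : clauseA ℓ m n i true ∈ Ax) (hW : clauseW (blockOf ℓ i) n true ∈ Ax)
    (hN : insert (w (blockOf ℓ i) 1, false) (clauseX ℓ m i) ∈ Ax) :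
    (derivationX ℓ m n i).IsFrom Ax ∧ (derivationX ℓ m n i).conclusion = clauseX ℓ m i ∧
      (derivationX ℓ m n i).ContainsMerge ∧ (derivationX ℓ m n i).length = 5 := by
  refine ⟨⟨hA, hW, ⟨?_, ?_⟩, hN, ⟨?_, ?_⟩, trivial⟩, ?_,
    Or.inl (isMerge_clauseA hn true), rfl⟩
  · simp [derivationX, clauseA]
  · simp [clauseW]
  · rw [show (derivationX ℓ m n i).start = clauseA ℓ m n i true from rfl, resolvent_clauseA hn]
    simp
  · simp
  · simp only [derivationX, conclusion, stepsConclusion]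
    rw [resolvent_clauseA hn]
    simp [InputStep.resolvent, InputStep.mainRest, InputStep.sideRest,
      Finset.erase_insert w_notMem_clauseX]

/-- The clause `x i`, where `x (m * ℓ)` is omitted. -/
def clauseReach (ℓ m i : ℕ) : Clause SepVar := if i = m * ℓ then ∅ else {(x i, true)}

/-- The steps resolving `clauseReach i` with the next `p` clauses `clauseX`. -/
def reachSteps (ℓ m : ℕ) : ℕ → ℕ → List (InputStep SepVar)
  | _, 0 => []
  | i, p + 1 => ⟨clauseX ℓ m (i + 1), x i, true⟩ :: reachSteps ℓ m (i + 1) p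

theorem length_reachSteps (ℓ m : ℕ) : ∀ p i, (reachSteps ℓ m i p).length = p
  | 0, _ => rfl
  | p + 1, i => by simp [reachSteps, length_reachSteps ℓ m p]

theorem reachSteps_valid {ℓ m : ℕ} {Ax : Set (Clause SepVar)}
    (hAx : ∀ i ∈ Finset.Icc 1 (m * ℓ), clauseX ℓ m i ∈ Ax) :
    ∀ p i, 1 ≤ i → i + p = m * ℓ → StepsValid Ax (clauseReach ℓ m i) (reachSteps ℓ m i p) ∧
      stepsConclusion (clauseReach ℓ m i) (reachSteps ℓ m i p) = ∅
  | 0, i, _, h => ⟨trivial, by simp_all [reachSteps, stepsConclusion, clauseReach]⟩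
  | p + 1, i, hi, h => by
      have hne : i ≠ m * ℓ := by omega
      have h0 : i ≠ 0 := by omega
      have hr : InputStep.resolvent ⟨clauseX ℓ m (i + 1), x i, true⟩ (clauseReach ℓ m i) =
          clauseReach ℓ m (i + 1) := by
        ext ⟨v, c⟩
        simp only [InputStep.resolvent, InputStep.mainRest, InputStep.sideRest, clauseReach,
          clauseX, hne, if_false]
        split_ifs <;> simp_all
        grind
      have ih := reachSteps_valid hAx p (i + 1) (by omega) (by omega)
      refine ⟨⟨hAx _ (Finset.mem_Icc.2 ⟨by omega, by omega⟩), ⟨?_, ?_⟩, ?_⟩, ?_⟩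
      · simp [clauseReach, hne]
      · simp [clauseX, h0]
      · simp only [hr]; exact ih.1
      · simp only [reachSteps, stepsConclusion, hr]; exact ih.2

/-- The final derivation, of the empty clause. -/
def derivationLast (ℓ m : ℕ) : InputDerivation SepVar where
  start := clauseX ℓ m 1
  steps := reachSteps ℓ m 1 (m * ℓ - 1)

theorem derivationLast_spec {ℓ m : ℕ} {Ax : Set (Clause SepVar)} (h : 0 < m * ℓ)
    (hAx : ∀ i ∈ Finset.Icc 1 (m * ℓ), clauseX ℓ m i ∈ Ax) :
    (derivationLast ℓ m).IsFrom Ax ∧ (derivationLast ℓ m).conclusion = ∅ ∧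
      (derivationLast ℓ m).length ≤ 2 * (m * ℓ) := by
  have h1 : clauseX ℓ m 1 = clauseReach ℓ m 1 := by simp [clauseX, clauseReach]
  have := reachSteps_valid hAx (m * ℓ - 1) 1 le_rfl (by omega)
  rw [← h1] at this
  refine ⟨⟨hAx _ (Finset.mem_Icc.2 ⟨le_rfl, h⟩), this.1⟩, this.2, ?_⟩
  rw [length_eq]
  simp only [derivationLast, length_reachSteps]
  omega

/-- The derivations of the equivalences of the first and last variable of each block. -/
def blockDerivations (ℓ n : ℕ) : List (InputDerivation SepVar) :=
  (List.range' 1 ℓ).map (derivationW n · true) ++ (List.range' 1 ℓ).map (derivationW n · false)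

/-- A refutation of linear length. -/
def refutation (ℓ m n : ℕ) : List (InputDerivation SepVar) :=
  (blockDerivations ℓ n ++ ((List.range' 1 (m * ℓ)).map (derivationN ℓ m n) ++
    (List.range' 1 (m * ℓ)).map (derivationX ℓ m n))) ++ [derivationLast ℓ m]

theorem isRMARefutation_refutation {ℓ m n : ℕ} (hn : 2 ≤ n) (hℓ : 0 < ℓ) (hm : 0 < m) :
    IsRMARefutation (F₁ ℓ m n) (refutation ℓ m n) := by
  have hr : ∀ {p i : ℕ}, i ∈ List.range' 1 p ↔ i ∈ Finset.Icc 1 p := by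
    intro p i; simp only [List.mem_range'_1, Finset.mem_Icc]; omega
  set Ax : Set (Clause SepVar) := ↑(F₁ ℓ m n)
  set AxW : Set (Clause SepVar) := Ax ∪ {C | ∃ d ∈ blockDerivations ℓ n, d.conclusion = C}
  have hW : ∀ i b, clauseW (blockOf ℓ i) n b ∈ AxW := by
    intro i b
    have hi := blockOf_mem hℓ i
    refine Or.inr ⟨derivationW n (blockOf ℓ i) b, ?_,
      (derivationW_spec (m := m) hn hi b).2.1⟩
    cases b
    · exact List.mem_append_right _ (List.mem_map_of_mem (hr.2 hi))
    · exact List.mem_append_left _ (List.mem_map_of_mem (hr.2 hi))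
  set AxN : Set (Clause SepVar) :=
    AxW ∪ {C | ∃ d ∈ (List.range' 1 (m * ℓ)).map (derivationN ℓ m n), d.conclusion = C}
  have hA : ∀ i ∈ Finset.Icc 1 (m * ℓ), ∀ b, clauseA ℓ m n i b ∈ AxW :=
    fun i hi b => Or.inl (clauseA_mem_F₁ hi b)
  have hX : ∀ i ∈ Finset.Icc 1 (m * ℓ), (derivationX ℓ m n i).IsFrom AxN ∧
      (derivationX ℓ m n i).conclusion = clauseX ℓ m i ∧ (derivationX ℓ m n i).ContainsMerge :=
    fun i hi => by
      have := derivationX_spec (Ax := AxN) hn (Or.inl (hA i hi true)) (Or.inl (hW i true))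
        (Or.inr ⟨_, List.mem_map_of_mem (hr.2 hi),
          (derivationN_spec hn (hA i hi false) (hW i false)).2.1⟩)
      exact ⟨this.1, this.2.1, this.2.2.1⟩
  refine ⟨⟨?_, ?_⟩, ?_⟩
  · refine inputStructured_append _ _ _ (inputStructured_append _ _ _ ?_
      (inputStructured_append _ _ _ ?_ ?_)) ⟨(derivationLast_spec (by positivity) ?_).1, trivial⟩
    · refine inputStructured_of_forall _ _ fun d hd => ?_
      rcases List.mem_append.1 hd with hd | hd <;>
      · obtain ⟨j, hj, rfl⟩ := List.mem_map.1 hd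
        exact (derivationW_spec hn (hr.1 hj) _).1
    · refine inputStructured_of_forall _ _ fun d hd => ?_
      obtain ⟨i, hi, rfl⟩ := List.mem_map.1 hd
      exact (derivationN_spec hn (hA i (hr.1 hi) _) (hW i _)).1
    · refine inputStructured_of_forall _ _ fun d hd => ?_
      obtain ⟨i, hi, rfl⟩ := List.mem_map.1 hd
      exact (hX i (hr.1 hi)).1
    · exact fun i hi => Or.inr ⟨derivationX ℓ m n i,
        List.mem_append_right _ (List.mem_append_right _ (List.mem_map_of_mem (hr.2 hi))),
        (hX i hi).2.1⟩
  · intro d hd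
    rw [refutation, List.dropLast_concat, blockDerivations] at hd
    simp only [List.mem_append, List.mem_map] at hd
    rcases hd with (⟨j, hj, rfl⟩ | ⟨j, hj, rfl⟩) | ⟨i, hi, rfl⟩ | ⟨i, hi, rfl⟩
    · exact (derivationW_spec (m := m) hn (hr.1 hj) _).2.2.1
    · exact (derivationW_spec (m := m) hn (hr.1 hj) _).2.2.1
    · exact (derivationN_spec hn (hA i (hr.1 hi) _) (hW i _)).2.2.1
    · exact (hX i (hr.1 hi)).2.2
  · refine ⟨derivationLast ℓ m, by simp [refutation], ?_⟩
    exact (derivationLast_spec (Ax := Set.univ) (by positivity) fun _ _ => trivial).2.1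

/-! ### Size of the refutation and of the formula -/

theorem sum_map_le {α : Type*} (f : α → ℕ) (c : ℕ) (l : List α) (h : ∀ a ∈ l, f a ≤ c) :
    (l.map f).sum ≤ l.length * c := by
  simpa using List.sum_le_card_nsmul (l.map f) c (by simpa using h)

theorem sequenceLength_refutation_le {ℓ m n : ℕ} (hn : 2 ≤ n) (hℓ : 0 < ℓ) (hm : 0 < m) :
    sequenceLength (refutation ℓ m n) ≤ 2 * (ℓ * (2 * n + 1)) + 10 * (m * ℓ) := by
  have h1 : ∀ b, ((List.range' 1 ℓ).map fun j => (derivationW n j b).length).sum ≤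
      ℓ * (2 * n + 1) := fun b => by
    refine (sum_map_le _ (2 * n + 1) _ fun j hj => ?_).trans (by simp)
    refine (derivationW_spec (ℓ := ℓ) (m := m) hn ?_ b).2.2.2.le
    simp only [List.mem_range'_1] at hj
    exact Finset.mem_Icc.2 ⟨by omega, by omega⟩
  have h2 : ((List.range' 1 (m * ℓ)).map fun i => (derivationN ℓ m n i).length).sum ≤
      m * ℓ * 3 := (sum_map_le _ 3 _ fun i _ => le_of_eq rfl).trans (by simp)
  have h3 : ((List.range' 1 (m * ℓ)).map fun i => (derivationX ℓ m n i).length).sum ≤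
      m * ℓ * 5 := (sum_map_le _ 5 _ fun i _ => le_of_eq rfl).trans (by simp)
  have h4 := (derivationLast_spec (ℓ := ℓ) (m := m) (Ax := Set.univ) (by positivity)
    fun _ _ => trivial).2.2
  have h5 := h1 true
  have h6 := h1 false
  simp only [sequenceLength, refutation, blockDerivations, List.map_append, List.map_map,
    List.sum_append, List.map_cons, List.map_nil, List.sum_cons, List.sum_nil, Function.comp_def]
  omega

theorem card_F₁_le (ℓ m n : ℕ) : (F₁ ℓ m n).card ≤ 2 * (ℓ * n) + 2 * (m * ℓ) + 4 * ℓ := by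
  have hB : ((Finset.Icc 1 ℓ).biUnion fun j => (Finset.Ico 1 n).biUnion fun k =>
      {clauseB j k true, clauseB j k false}).card ≤ ℓ * (n * 2) := by
    refine (Finset.card_biUnion_le_card_mul _ _ (n * 2) fun j _ => ?_).trans (by simp)
    refine (Finset.card_biUnion_le_card_mul _ _ 2 fun k _ => Finset.card_le_two).trans ?_
    simp
  have hA : ((Finset.Icc 1 (m * ℓ)).biUnion fun i =>
      {clauseA ℓ m n i true, clauseA ℓ m n i false}).card ≤ m * ℓ * 2 :=
    (Finset.card_biUnion_le_card_mul _ _ 2 fun k _ => Finset.card_le_two).trans (by simp)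
  have hE : ((Finset.Icc 1 ℓ).biUnion extra).card ≤ ℓ * 4 :=
    (Finset.card_biUnion_le_card_mul _ _ 4 fun k _ => Finset.card_le_four).trans (by simp)
  have h1 := Finset.card_union_le (F ℓ m n) ((Finset.Icc 1 ℓ).biUnion extra)
  have h2 : (F ℓ m n).card ≤ _ := Finset.card_union_le _ _
  rw [F₁]
  nlinarith

theorem vars_F₁_subset {ℓ m n : ℕ} (hn : 2 ≤ n) (hℓ : 0 < ℓ) :
    CNF.vars (F₁ ℓ m n) ⊆ (Finset.range (m * ℓ)).image x ∪
      (Finset.Icc 1 ℓ ×ˢ Finset.Icc 1 n).image (fun p => w p.1 p.2) ∪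
      (Finset.Icc 1 ℓ).image y ∪ (Finset.Icc 1 ℓ).image z := by
  intro v hv
  simp only [CNF.vars, Clause.vars, Finset.mem_biUnion, Finset.mem_image, Prod.exists,
    exists_and_right, exists_eq_right] at hv
  obtain ⟨C, hC, c, hv⟩ := hv
  simp only [Finset.mem_union, Finset.mem_image, Finset.mem_product, Prod.exists]
  simp only [F₁, F, Finset.mem_union, Finset.mem_biUnion] at hC
  rcases hC with (⟨j, hj, k, hk, hC⟩ | ⟨i, hi, hC⟩) | ⟨j, hj, hC⟩
  · simp only [Finset.mem_insert, Finset.mem_singleton] at hC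
    simp only [Finset.mem_Ico] at hk
    left; left; right
    rcases hC with rfl | rfl <;>
    · simp only [clauseB, Finset.mem_insert, Finset.mem_singleton, Prod.mk.injEq] at hv
      rcases hv with ⟨rfl, -⟩ | ⟨rfl, -⟩
      · exact ⟨_, _, ⟨hj, Finset.mem_Icc.2 ⟨by omega, by omega⟩⟩, rfl⟩
      · exact ⟨_, _, ⟨hj, Finset.mem_Icc.2 ⟨by omega, by omega⟩⟩, rfl⟩
  · have hC' : ∃ b, C = clauseA ℓ m n i b := by
      simp only [Finset.mem_insert, Finset.mem_singleton] at hC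
      exact hC.elim (⟨_, ·⟩) (⟨_, ·⟩)
    obtain ⟨b, rfl⟩ := hC'
    simp only [Finset.mem_Icc] at hi
    simp only [clauseA, Finset.mem_union, Finset.mem_insert, Finset.mem_singleton,
      Prod.mk.injEq] at hv
    rcases hv with (⟨rfl, -⟩ | ⟨rfl, -⟩) | hv
    · left; left; right
      exact ⟨_, _, ⟨blockOf_mem hℓ i, Finset.mem_Icc.2 ⟨by omega, by omega⟩⟩, rfl⟩
    · left; left; right
      exact ⟨_, _, ⟨blockOf_mem hℓ i, Finset.mem_Icc.2 ⟨by omega, by omega⟩⟩, rfl⟩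
    · left; left; left
      unfold clauseX at hv
      split_ifs at hv <;> simp at hv
      · exact ⟨i, by simp; omega, hv.1.symm⟩
      · exact ⟨i - 1, by simp; omega, hv.1.symm⟩
      · rcases hv with hv | hv
        · exact ⟨i - 1, by simp; omega, hv.1.symm⟩
        · exact ⟨i, by simp; omega, hv.1.symm⟩
  · simp only [extra, Finset.mem_insert, Finset.mem_singleton] at hC
    have h1 : (1 : ℕ) ∈ Finset.Icc 1 n := Finset.mem_Icc.2 ⟨by omega, by omega⟩
    have h2 : (2 : ℕ) ∈ Finset.Icc 1 n := Finset.mem_Icc.2 ⟨by omega, by omega⟩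
    rcases hC with rfl | rfl | rfl | rfl <;>
      simp only [Finset.mem_insert, Finset.mem_singleton, Prod.mk.injEq] at hv <;> grind

theorem card_vars_F₁_le {ℓ m n : ℕ} (hn : 2 ≤ n) (hℓ : 0 < ℓ) :
    (CNF.vars (F₁ ℓ m n)).card ≤ m * ℓ + ℓ * n + 2 * ℓ := by
  refine (Finset.card_le_card (vars_F₁_subset hn hℓ)).trans ?_
  refine (Finset.card_union_le _ _).trans ?_
  have h1 := Finset.card_union_le ((Finset.range (m * ℓ)).image x ∪
      (Finset.Icc 1 ℓ ×ˢ Finset.Icc 1 n).image (fun p => w p.1 p.2)) ((Finset.Icc 1 ℓ).image y)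
  have h2 := Finset.card_union_le ((Finset.range (m * ℓ)).image x)
      ((Finset.Icc 1 ℓ ×ˢ Finset.Icc 1 n).image (fun p => w p.1 p.2))
  have h3 : ((Finset.range (m * ℓ)).image x).card ≤ m * ℓ := by
    simpa using Finset.card_image_le (s := Finset.range (m * ℓ)) (f := x)
  have h4 : ((Finset.Icc 1 ℓ ×ˢ Finset.Icc 1 n).image (fun p => w p.1 p.2)).card ≤ ℓ * n := by
    simpa using Finset.card_image_le (s := Finset.Icc 1 ℓ ×ˢ Finset.Icc 1 n)
      (f := fun p : ℕ × ℕ => w p.1 p.2)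
  have h5 : ((Finset.Icc 1 ℓ).image y).card ≤ ℓ := by
    simpa using Finset.card_image_le (s := Finset.Icc 1 ℓ) (f := y)
  have h6 : ((Finset.Icc 1 ℓ).image z).card ≤ ℓ := by
    simpa using Finset.card_image_le (s := Finset.Icc 1 ℓ) (f := z)
  omega

end SepFormula

/-! ### Tautologies in regular derivations -/

section Tautology

variable {V : Type} [DecidableEq V]

/-- A clause is a tautology if it contains a pair of opposite literals. -/
def Clause.Tautology (C : Clause V) : Prop := ∃ v c, (v, c) ∈ C ∧ (v, !c) ∈ C

theorem mem_resolvent {s : InputStep V} {C : Clause V} {v : V} {c : Bool} :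
    (v, c) ∈ s.resolvent C ↔ ((v, c) ≠ (s.pivot, s.sign) ∧ (v, c) ∈ C) ∨
      ((v, c) ≠ (s.pivot, !s.sign) ∧ (v, c) ∈ s.side) := by
  simp [InputStep.resolvent, InputStep.mainRest, InputStep.sideRest]

theorem mem_vars_of_mem {C : Clause V} {v : V} {c : Bool} (h : (v, c) ∈ C) :
    v ∈ Clause.vars C := Finset.mem_image.2 ⟨_, h, rfl⟩

/-- A step erases only one literal of the pivot variable from each premise, so a premise
tautological in the pivot would leave the pivot in the resolvent. Hence the opposite pair is on
another variable and survives. Under strong regularity tautologies thus propagate to the conclusion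
and can be disregarded. -/
theorem tautology_resolvent {s : InputStep V} {C : Clause V}
    (hp : s.pivot ∉ Clause.vars (s.resolvent C)) (h : C.Tautology ∨ s.side.Tautology) :
    (s.resolvent C).Tautology := by
  have aux : ∀ c, (s.pivot, c) ∉ s.resolvent C := fun c hc => hp (mem_vars_of_mem hc)
  rcases h with ⟨v, c, h₁, h₂⟩ | ⟨v, c, h₁, h₂⟩
  · have hv : v ≠ s.pivot := by
      rintro rfl
      by_cases hc : c = s.sign
      · exact aux (!c) (mem_resolvent.2 (Or.inl ⟨by simp [hc], h₂⟩))
      · exact aux c (mem_resolvent.2 (Or.inl ⟨by simp [hc], h₁⟩))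
    exact ⟨v, c, mem_resolvent.2 (Or.inl ⟨by simp [hv], h₁⟩),
      mem_resolvent.2 (Or.inl ⟨by simp [hv], h₂⟩)⟩
  · have hv : v ≠ s.pivot := by
      rintro rfl
      by_cases hc : c = !s.sign
      · exact aux (!c) (mem_resolvent.2 (Or.inr ⟨by simp [hc], h₂⟩))
      · exact aux c (mem_resolvent.2 (Or.inr ⟨by simp [hc], h₁⟩))
    exact ⟨v, c, mem_resolvent.2 (Or.inr ⟨by simp [hv], h₁⟩),
      mem_resolvent.2 (Or.inr ⟨by simp [hv], h₂⟩)⟩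

theorem head_mem_stepsClauses (ss : List (InputStep V)) (C : Clause V) :
    C ∈ stepsClauses C ss := by
  cases ss <;> simp [stepsClauses]

theorem side_mem_stepsClauses : ∀ (ss : List (InputStep V)) (C : Clause V),
    ∀ s ∈ ss, s.side ∈ stepsClauses C ss
  | s :: ss, C, t, ht => by
      rcases List.mem_cons.1 ht with rfl | ht
      · simp [stepsClauses]
      · simp [stepsClauses, side_mem_stepsClauses ss (s.resolvent C) t ht]

theorem pivot_notMem_resolvent {s : InputStep V} {ss : List (InputStep V)} {C : Clause V}
    (h : StepsRegular C (s :: ss)) : s.pivot ∉ Clause.vars (s.resolvent C) :=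
  h.1 _ (head_mem_stepsClauses _ _)

theorem tautology_conclusion : ∀ (ss : List (InputStep V)) (C : Clause V),
    StepsRegular C ss → C.Tautology → (stepsConclusion C ss).Tautology
  | [], _, _, h => h
  | _ :: ss, _, hr, h => tautology_conclusion ss _ hr.2
      (tautology_resolvent (pivot_notMem_resolvent hr) (Or.inl h))

end Tautology

namespace SepFormula

open SepVar

/-! ### Derivations inside a block -/

/-- The block of a variable; the variables `x i` are in no block. -/
def block? : SepVar → Option ℕ
  | x _ => none
  | w j _ => some j
  | y j => some j
  | z j => some j

/-- The axioms of block `j`. -/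
def LocalAxiom (j : ℕ) (D : Clause SepVar) : Prop :=
  (∃ k b, 1 ≤ k ∧ D = clauseB j k b) ∨ D ∈ extra j

/-- Every literal belongs to block `j`. -/
def InBlock (j : ℕ) (D : Clause SepVar) : Prop := ∀ v c, (v, c) ∈ D → block? v = some j

theorem LocalAxiom.inBlock {j : ℕ} {D : Clause SepVar} (h : LocalAxiom j D) : InBlock j D := by
  intro v c hv
  rcases h with ⟨k, b, -, rfl⟩ | h
  · simp only [clauseB, Finset.mem_insert, Finset.mem_singleton, Prod.mk.injEq] at hv
    rcases hv with ⟨rfl, -⟩ | ⟨rfl, -⟩ <;> rfl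
  · simp only [extra, Finset.mem_insert, Finset.mem_singleton] at h
    rcases h with rfl | rfl | rfl | rfl <;>
      simp only [Finset.mem_insert, Finset.mem_singleton, Prod.mk.injEq] at hv <;>
      grind [block?]

/-- At most one literal of each sign among the variables `w j k` with `k ≥ 2`. -/
def OneOfEachSign (j : ℕ) (D : Clause SepVar) : Prop :=
  ∀ k k' c, 2 ≤ k → 2 ≤ k' → (w j k, c) ∈ D → (w j k', c) ∈ D → k = k'

theorem LocalAxiom.oneOfEachSign {j : ℕ} {D : Clause SepVar} (h : LocalAxiom j D) :
    OneOfEachSign j D := by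
  intro k k' c hk hk' h₁ h₂
  rcases h with ⟨k₀, b, -, rfl⟩ | h
  · simp only [clauseB, Finset.mem_insert, Finset.mem_singleton, Prod.mk.injEq, w.injEq,
      true_and] at h₁ h₂
    cases b <;> cases c <;> simp_all
  · simp only [extra, Finset.mem_insert, Finset.mem_singleton] at h
    rcases h with rfl | rfl | rfl | rfl <;>
      simp only [Finset.mem_insert, Finset.mem_singleton, Prod.mk.injEq, w.injEq, reduceCtorEq,
        false_and, or_false] at h₁ h₂ <;> omega

/-- The sign of the literal of `w j 2` in the axioms of block `j` that contain the given literal,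
for the literals of the variables of block `j` other than `w j k` with `k ≥ 2`. -/
def forcedSign : SepVar → Bool → Bool
  | y _, c => c
  | _, c => !c

/-- The variables `w j k` with `k ≥ 2`. -/
def IsInner (j : ℕ) (v : SepVar) : Prop := ∃ k, 2 ≤ k ∧ v = w j k

theorem forcedSign_not (v : SepVar) (c : Bool) : forcedSign v (!c) = !forcedSign v c := by
  cases v <;> rfl

/-- Literals on outer variables are accompanied by the corresponding literal of `w j 2`. -/
def Forcing (j : ℕ) (D : Clause SepVar) : Prop :=
  ∀ v c, (v, c) ∈ D → ¬IsInner j v → (w j 2, forcedSign v c) ∈ D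

theorem LocalAxiom.forcing {j : ℕ} {D : Clause SepVar} (h : LocalAxiom j D) :
    Forcing j D := by
  intro v c hv hin
  rcases h with ⟨k, b, hk, rfl⟩ | h
  · simp only [clauseB, Finset.mem_insert, Finset.mem_singleton, Prod.mk.injEq] at hv
    rcases hv with ⟨rfl, rfl⟩ | ⟨rfl, rfl⟩
    · have : k = 1 := by
        by_contra hk'
        exact hin ⟨k, by omega, rfl⟩
      subst this
      simp [clauseB, forcedSign]
    · exact absurd ⟨k + 1, by omega, rfl⟩ hin
  · have h2 : IsInner j (w j 2) := ⟨2, le_rfl, rfl⟩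
    simp only [extra, Finset.mem_insert, Finset.mem_singleton] at h
    rcases h with rfl | rfl | rfl | rfl <;>
      simp only [Finset.mem_insert, Finset.mem_singleton, Prod.mk.injEq] at hv ⊢ <;>
      grind [forcedSign]

section LocalStep

variable {j : ℕ} {s : InputStep SepVar} {G : Clause SepVar}

/-- In a non-tautological step inside a block, while `w j 2` is available, the pivot is one of
the inner variables. -/
theorem isInner_pivot (ha : s.Applies G) (hs : LocalAxiom j s.side)
    (ht : ¬(s.resolvent G).Tautology) (hG : Forcing j G ∨ w j 2 ∉ Clause.vars s.side) :
    IsInner j s.pivot := by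
  by_contra hin
  have h₁ := hs.forcing _ _ ha.2 hin
  rcases hG with hG | hG
  · have h₂ := hG _ _ ha.1 hin
    have hne : w j 2 ≠ s.pivot := fun h => hin ⟨2, le_rfl, h.symm⟩
    -- The opposite pivot literals force opposite literals of `w j 2` in the two premises, and
    -- neither is erased.
    refine ht ⟨w j 2, forcedSign s.pivot s.sign, mem_resolvent.2 (Or.inl ⟨by simp [hne], h₂⟩),
      mem_resolvent.2 (Or.inr ⟨by simp [hne], ?_⟩)⟩
    rwa [← forcedSign_not]
  · exact hG (mem_vars_of_mem h₁)

/-- In each premise the pivot literal is the only inner literal of its sign. Erasing it leaves the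
other premise as the only source of that sign. -/
theorem oneOfEachSign_resolvent (ha : s.Applies G) (hs : OneOfEachSign j s.side)
    (hG : OneOfEachSign j G) (hp : IsInner j s.pivot) : OneOfEachSign j (s.resolvent G) := by
  obtain ⟨p, hp, hpv⟩ := hp
  have key : ∀ k k' c, 2 ≤ k → 2 ≤ k' → (w j k, c) ∈ G → (w j k, c) ≠ (s.pivot, s.sign) →
      (w j k', c) ∈ s.side → (w j k', c) ≠ (s.pivot, !s.sign) → False := by
    intro k k' c hk hk' h₁ h₁' h₂ h₂'
    have a₁ := ha.1
    have a₂ := ha.2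
    rw [hpv] at a₁ a₂ h₁' h₂'
    by_cases hc : c = s.sign
    · rw [← hc] at a₁ h₁'
      exact h₁' (by rw [hG k p c hk hp h₁ a₁])
    · have hc' : c = !s.sign := by cases c <;> cases hh : s.sign <;> simp_all
      rw [← hc'] at a₂ h₂'
      exact h₂' (by rw [hs k' p c hk' hp h₂ a₂])
  intro k k' c hk hk' h₁ h₂
  rcases mem_resolvent.1 h₁ with h₁ | h₁ <;> rcases mem_resolvent.1 h₂ with h₂ | h₂
  · exact hG k k' c hk hk' h₁.2 h₂.2
  · exact (key k k' c hk hk' h₁.2 h₁.1 h₂.2 h₂.1).elim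
  · exact (key k' k c hk' hk h₂.2 h₂.1 h₁.2 h₁.1).elim
  · exact hs k k' c hk hk' h₁.2 h₂.2

/-- A shared inner literal has the sign of the pivot literal of one premise, hence equals it, but
that literal is erased. A shared outer literal forces the same literal of `w j 2` in both premises.
Then the pivot is `w j 2` itself and one premise is a tautology. -/
theorem not_isMerge (ha : s.Applies G) (hs : LocalAxiom j s.side) (hG : OneOfEachSign j G)
    (ht : ¬G.Tautology) (ht' : ¬s.side.Tautology)
    (hf : Forcing j G ∨ w j 2 ∉ Clause.vars s.side) (hp : IsInner j s.pivot) :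
    ¬s.IsMerge G := by
  rintro ⟨⟨v, c⟩, hv⟩
  simp only [InputStep.mainRest, InputStep.sideRest, Finset.mem_inter, Finset.mem_erase] at hv
  obtain ⟨⟨h₁', h₁⟩, h₂', h₂⟩ := hv
  obtain ⟨p, hp, hpv⟩ := hp
  have a₁ := ha.1
  have a₂ := ha.2
  rw [hpv] at a₁ a₂ h₁' h₂'
  have sgn : ∀ c : Bool, c = s.sign ∨ c = !s.sign := by
    intro c; cases c <;> cases hh : s.sign <;> simp_all
  by_cases hin : IsInner j v
  · obtain ⟨k, hk, rfl⟩ := hin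
    rcases sgn c with hc | hc
    · rw [← hc] at a₁ h₁'
      exact h₁' (by rw [hG k p c hk hp h₁ a₁])
    · rw [← hc] at a₂ h₂'
      exact h₂' (by rw [hs.oneOfEachSign k p c hk hp h₂ a₂])
  · have f₂ := hs.forcing _ _ h₂ hin
    rcases hf with hf | hf
    · have f₁ := hf _ _ h₁ hin
      rcases sgn (forcedSign v c) with hc | hc
      · have hp2 : 2 = p := hG 2 p s.sign le_rfl hp (hc ▸ f₁) a₁
        subst hp2
        exact ht' ⟨_, _, hc ▸ f₂, a₂⟩
      · have hp2 : 2 = p := hs.oneOfEachSign 2 p (!s.sign) le_rfl hp (hc ▸ f₂) a₂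
        subst hp2
        exact ht ⟨_, _, a₁, hc ▸ f₁⟩
    · exact hf (mem_vars_of_mem f₂)

theorem forcing_resolvent (hs : Forcing j s.side) (hG : Forcing j G)
    (hp : s.pivot ≠ w j 2) : Forcing j (s.resolvent G) := by
  intro v c hv hin
  rcases mem_resolvent.1 hv with h | h
  · exact mem_resolvent.2 (Or.inl ⟨by simp [hp.symm], hG _ _ h.2 hin⟩)
  · exact mem_resolvent.2 (Or.inr ⟨by simp [hp.symm], hs _ _ h.2 hin⟩)

end LocalStep

/-! ### Falsified clauses -/

/-- All literals of `C` on variables outside the blocks in `S` are false under `β`. -/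
def FalseOff (S : Set ℕ) (β : SepVar → Bool) (C : Clause SepVar) : Prop :=
  ∀ v c, (v, c) ∈ C → (∀ j ∈ S, block? v ≠ some j) → β v = !c

theorem FalseOff.of_inBlock {S : Set ℕ} {j : ℕ} (hj : j ∉ S) {β : SepVar → Bool}
    {C : Clause SepVar} (hb : InBlock j C) (hC : FalseOff S β C) : FalseOff ∅ β C := by
  refine fun v c hv _ => hC v c hv fun i hi h => hj ?_
  rw [hb v c hv] at h
  cases h
  exact hi

theorem falseOff_main {S : Set ℕ} {β : SepVar → Bool} {s : InputStep SepVar}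
    {C : Clause SepVar} (h : FalseOff S β (s.resolvent C))
    (hp : (∃ j ∈ S, block? s.pivot = some j) ∨ β s.pivot = !s.sign) : FalseOff S β C := by
  intro v c hv hS
  by_cases he : (v, c) = (s.pivot, s.sign)
  · obtain ⟨rfl, rfl⟩ := Prod.mk.inj he
    rcases hp with ⟨j, hj, hp⟩ | hp
    · exact (hS j hj hp).elim
    · exact hp
  · exact h v c (mem_resolvent.2 (Or.inl ⟨he, hv⟩)) hS

theorem falseOff_side {S : Set ℕ} {β : SepVar → Bool} {s : InputStep SepVar}
    {C : Clause SepVar} (h : FalseOff S β (s.resolvent C))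
    (hp : (∃ j ∈ S, block? s.pivot = some j) ∨ β s.pivot = s.sign) : FalseOff S β s.side := by
  intro v c hv hS
  by_cases he : (v, c) = (s.pivot, !s.sign)
  · obtain ⟨rfl, rfl⟩ := Prod.mk.inj he
    rcases hp with ⟨j, hj, hp⟩ | hp
    · exact (hS j hj hp).elim
    · simpa using hp
  · exact h v c (mem_resolvent.2 (Or.inr ⟨he, hv⟩)) hS

/-! ### The nodes of a refutation -/

/-- A clause together with the set of those `(j, k)` such that clauses `clauseB j k _` are used
in its derivation from earlier nodes. -/
abbrev Node := Clause SepVar × Finset (ℕ × ℕ)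

/-- The clauses of the nodes in `L` and the axioms `clauseA`. -/
def Source (ℓ m n : ℕ) (L : List Node) (D : Clause SepVar) : Prop :=
  (∃ p ∈ L, p.1 = D) ∨ ∃ i ∈ Finset.Icc 1 (m * ℓ), ∃ b, D = clauseA ℓ m n i b

/-- The axioms of block `j`, or those clauses `clauseB` listed in `O`, are falsified. -/
def LocallyFalse (j : ℕ) (β : SepVar → Bool) (O : Finset (ℕ × ℕ)) : Prop :=
  (∃ k b, (j, k) ∈ O ∧ FalseOff ∅ β (clauseB j k b)) ∨ ∃ D ∈ extra j, FalseOff ∅ β D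

theorem LocallyFalse.mono {j : ℕ} {β : SepVar → Bool} {O O' : Finset (ℕ × ℕ)} (h : O ⊆ O')
    (hO : LocallyFalse j β O) : LocallyFalse j β O' :=
  hO.imp (fun ⟨k, b, hk, hb⟩ => ⟨k, b, h hk, hb⟩) id

/-- The node `(C, O)` is justified by the nodes in `L`. -/
structure Supported (ℓ m n : ℕ) (L : List Node) (C : Clause SepVar) (O : Finset (ℕ × ℕ)) :
    Prop where
  falseOff : ∀ S β, FalseOff S β C →
    (∃ D, Source ℓ m n L D ∧ FalseOff S β D) ∨ ∃ j ∉ S, LocallyFalse j β O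
  subset : ∀ p ∈ O, ∃ D, Source ℓ m n L D ∧
    ∀ v c, (v, c) ∈ D → block? v ≠ some p.1 → (v, c) ∈ C

/-- Every node is justified by the nodes behind it. -/
def Justified (ℓ m n : ℕ) : List Node → Prop
  | [] => True
  | p :: L => Supported ℓ m n L p.1 p.2 ∧ Justified ℓ m n L

/-- The total number of clauses `clauseB` used. -/
def totalUse (L : List Node) : ℕ := (L.map fun p => p.2.card).sum

theorem Source.mono {ℓ m n : ℕ} {L L' : List Node} (h : L ⊆ L') {D : Clause SepVar}
    (hD : Source ℓ m n L D) : Source ℓ m n L' D :=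
  hD.imp (fun ⟨p, hp, he⟩ => ⟨p, h hp, he⟩) id

/-- The non-tautological axioms are either sources or local. -/
def Classified (ℓ m n : ℕ) (L : List Node) (Ax : Set (Clause SepVar)) : Prop :=
  ∀ D ∈ Ax, ¬D.Tautology → Source ℓ m n L D ∨ ∃ j, LocalAxiom j D

theorem Classified.mono {ℓ m n : ℕ} {L L' : List Node} (h : L ⊆ L') {Ax : Set (Clause SepVar)}
    (hA : Classified ℓ m n L Ax) : Classified ℓ m n L' Ax :=
  fun D hD ht => (hA D hD ht).imp (Source.mono h) id

theorem exists_localUse {j : ℕ} {D : Clause SepVar} (h : LocalAxiom j D) :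
    ∃ O : Finset (ℕ × ℕ), O.card ≤ 1 ∧ (∀ p ∈ O, p.1 = j) ∧
      ∀ β, FalseOff ∅ β D → LocallyFalse j β O := by
  rcases h with ⟨k, b, -, rfl⟩ | h
  · exact ⟨{(j, k)}, by simp, by simp, fun β hβ => Or.inl ⟨k, b, by simp, hβ⟩⟩
  · exact ⟨∅, by simp, by simp, fun β hβ => Or.inr ⟨D, h, hβ⟩⟩

section Supported

variable {ℓ m n : ℕ} {L : List Node} {s : InputStep SepVar} {C : Clause SepVar}

theorem pivot_cases (S : Set ℕ) (β : SepVar → Bool) (s : InputStep SepVar) :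
    (∃ j ∈ S, block? s.pivot = some j) ∨ (¬∃ j ∈ S, block? s.pivot = some j) ∧
      (β s.pivot = s.sign ∨ β s.pivot = !s.sign) := by
  by_cases h : ∃ j ∈ S, block? s.pivot = some j
  · exact Or.inl h
  · exact Or.inr ⟨h, by cases β s.pivot <;> cases s.sign <;> simp⟩

/-- If the pivot lies in a disregarded block, either premise is still false off `S`. Otherwise `β`
selects the false one. -/
theorem supported_source_source (hC : Source ℓ m n L C) (hs : Source ℓ m n L s.side) :
    Supported ℓ m n L (s.resolvent C) ∅ := by
  refine ⟨fun S β h => Or.inl ?_, by simp⟩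
  rcases pivot_cases S β s with hp | ⟨-, hp | hp⟩
  · exact ⟨C, hC, falseOff_main h (Or.inl hp)⟩
  · exact ⟨_, hs, falseOff_side h (Or.inr hp)⟩
  · exact ⟨C, hC, falseOff_main h (Or.inr hp)⟩

/-- The pivot is in block `j`. When `j ∈ S` the trace may always follow the source, so local axioms
of disregarded blocks are never reached. Since only a literal of block `j` is erased from the
source, the rest of it survives in the resolvent, which is the second condition of `Supported`. -/
theorem supported_source_local {j : ℕ} {O : Finset (ℕ × ℕ)} (ha : s.Applies C)
    (hC : Source ℓ m n L C) (hb : InBlock j s.side) (hO : ∀ p ∈ O, p.1 = j)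
    (hs : ∀ β, FalseOff ∅ β s.side → LocallyFalse j β O) :
    Supported ℓ m n L (s.resolvent C) O := by
  have hpj := hb _ _ ha.2
  refine ⟨fun S β h => ?_, fun p hp => ⟨C, hC, fun v c hv hj => ?_⟩⟩
  · rcases pivot_cases S β s with hp | ⟨hS, hp | hp⟩
    · exact Or.inl ⟨C, hC, falseOff_main h (Or.inl hp)⟩
    · have hjS : j ∉ S := fun hj => hS ⟨j, hj, hpj⟩
      exact Or.inr ⟨j, hjS, hs β ((falseOff_side h (Or.inr hp)).of_inBlock hjS hb)⟩
    · exact Or.inl ⟨C, hC, falseOff_main h (Or.inr hp)⟩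
  · refine mem_resolvent.2 (Or.inl ⟨fun he => hj ?_, hv⟩)
    rw [(Prod.mk.inj he).1, hpj, hO p hp]

theorem supported_local_source {j : ℕ} {O : Finset (ℕ × ℕ)} (ha : s.Applies C)
    (hs : Source ℓ m n L s.side) (hb : InBlock j C) (hO : ∀ p ∈ O, p.1 = j)
    (hC : ∀ β, FalseOff ∅ β C → LocallyFalse j β O) :
    Supported ℓ m n L (s.resolvent C) O := by
  have hpj := hb _ _ ha.1
  refine ⟨fun S β h => ?_, fun p hp => ⟨_, hs, fun v c hv hj => ?_⟩⟩
  · rcases pivot_cases S β s with hp | ⟨hS, hp | hp⟩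
    · exact Or.inl ⟨_, hs, falseOff_side h (Or.inl hp)⟩
    · exact Or.inl ⟨_, hs, falseOff_side h (Or.inr hp)⟩
    · have hjS : j ∉ S := fun hj => hS ⟨j, hj, hpj⟩
      exact Or.inr ⟨j, hjS, hC β ((falseOff_main h (Or.inr hp)).of_inBlock hjS hb)⟩
  · refine mem_resolvent.2 (Or.inr ⟨fun he => hj ?_, hv⟩)
    rw [(Prod.mk.inj he).1, hpj, hO p hp]

end Supported

/-! ### Extraction of nodes from a refutation -/

/-- The steps of a strongly regular derivation from a source yield further nodes. -/
theorem exists_nodes_of_source {ℓ m n : ℕ} {Ax : Set (Clause SepVar)} :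
    ∀ (ss : List (InputStep SepVar)) (C : Clause SepVar) (L : List Node),
      Justified ℓ m n L → Classified ℓ m n L Ax → Source ℓ m n L C →
      StepsValid Ax C ss → StepsRegular C ss →
      ∃ L', L ⊆ L' ∧ Justified ℓ m n L' ∧ L'.length ≤ L.length + ss.length ∧
        totalUse L' ≤ totalUse L + ss.length ∧
        ((stepsConclusion C ss).Tautology ∨ Source ℓ m n L' (stepsConclusion C ss))
  | [], C, L, hL, _, hC, _, _ => ⟨L, List.Subset.refl _, hL, le_rfl, le_rfl, Or.inr hC⟩
  | s :: ss, C, L, hL, hA, hC, hv, hr => by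
      by_cases ht : (s.resolvent C).Tautology
      · exact ⟨L, List.Subset.refl _, hL, Nat.le_add_right _ _, Nat.le_add_right _ _,
          Or.inl (tautology_conclusion ss _ hr.2 ht)⟩
      have hts : ¬s.side.Tautology := fun h =>
        ht (tautology_resolvent (pivot_notMem_resolvent hr) (Or.inr h))
      obtain ⟨O, hO, hsup⟩ : ∃ O : Finset (ℕ × ℕ), O.card ≤ 1 ∧
          Supported ℓ m n L (s.resolvent C) O := by
        rcases hA _ hv.1 hts with hs | ⟨j, hs⟩
        · exact ⟨∅, by simp, supported_source_source hC hs⟩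
        · obtain ⟨O, hO, hOj, hOf⟩ := exists_localUse hs
          exact ⟨O, hO, supported_source_local hv.2.1 hC hs.inBlock hOj hOf⟩
      have hsub : L ⊆ (s.resolvent C, O) :: L := List.subset_cons_self _ _
      obtain ⟨L', h₁, h₂, h₃, h₄, h₅⟩ := exists_nodes_of_source ss (s.resolvent C)
        ((s.resolvent C, O) :: L) ⟨hsup, hL⟩ (hA.mono hsub)
        (Or.inl ⟨_, List.mem_cons_self, rfl⟩) hv.2.2 hr.2
      refine ⟨L', List.Subset.trans hsub h₁, h₂, ?_, ?_, h₅⟩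
      · simp only [List.length_cons] at h₃ ⊢; omega
      · simp only [totalUse, List.map_cons, List.sum_cons, List.length_cons] at h₄ ⊢; omega

/-- The invariants of a derivation inside block `j` that has used the clauses `clauseB` listed
in `O`. -/
structure LocalClause (j : ℕ) (O : Finset (ℕ × ℕ)) (G : Clause SepVar) : Prop where
  notTaut : ¬G.Tautology
  inBlock : InBlock j G
  one : OneOfEachSign j G
  use : ∀ p ∈ O, p.1 = j
  falseOff : ∀ β, FalseOff ∅ β G → LocallyFalse j β O

/-- The axioms of a block are satisfiable: set all `y` to false and everything else to true. -/
theorem LocalClause.ne_empty {j : ℕ} {O : Finset (ℕ × ℕ)} {G : Clause SepVar}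
    (h : LocalClause j O G) : G ≠ ∅ := by
  rintro rfl
  rcases h.falseOff (fun v => match v with | y _ => false | _ => true)
    (by intro v c hv; simp at hv) with ⟨k, b, -, hf⟩ | ⟨D, hD, hf⟩
  · have h₁ := hf (w j k) b (by simp [clauseB]) (by simp)
    have h₂ := hf (w j (k + 1)) (!b) (by simp [clauseB]) (by simp)
    clear hf; cases b <;> simp at h₁ h₂
  · simp only [extra, Finset.mem_insert, Finset.mem_singleton] at hD
    rcases hD with rfl | rfl | rfl | rfl
    · simpa using hf (w j 2) true (by simp) (by simp)
    · simpa using hf (z j) true (by simp) (by simp)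
    · simpa using hf (w j 1) true (by simp) (by simp)
    · simpa using hf (w j 2) true (by simp) (by simp)

/-- A strongly regular derivation whose clauses so far are local yields nodes, unless it stays
local; then it contains no merge. -/
theorem exists_nodes_of_local {ℓ m n j : ℕ} {Ax : Set (Clause SepVar)} :
    ∀ (ss : List (InputStep SepVar)) (G : Clause SepVar) (O : Finset (ℕ × ℕ)) (L : List Node),
      Justified ℓ m n L → Classified ℓ m n L Ax → LocalClause j O G →
      (Forcing j G ∨ ∀ s ∈ ss, w j 2 ∉ Clause.vars s.side) →
      StepsValid Ax G ss → StepsRegular G ss →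
      ∃ L', L ⊆ L' ∧ Justified ℓ m n L' ∧ L'.length ≤ L.length + ss.length ∧
        totalUse L' ≤ totalUse L + O.card + ss.length ∧
        ((stepsConclusion G ss).Tautology ∨ Source ℓ m n L' (stepsConclusion G ss) ∨
          stepsConclusion G ss ≠ ∅ ∧ ¬StepsMerge G ss)
  | [], G, O, L, hL, _, hG, _, _, _ => ⟨L, List.Subset.refl _, hL, le_rfl, by omega,
      Or.inr (Or.inr ⟨hG.ne_empty, id⟩)⟩
  | s :: ss, G, O, L, hL, hA, hG, hf, hv, hr => by
      by_cases ht : (s.resolvent G).Tautology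
      · exact ⟨L, List.Subset.refl _, hL, Nat.le_add_right _ _, by omega,
          Or.inl (tautology_conclusion ss _ hr.2 ht)⟩
      have hts : ¬s.side.Tautology := fun h =>
        ht (tautology_resolvent (pivot_notMem_resolvent hr) (Or.inr h))
      rcases hA _ hv.1 hts with hs | ⟨i, hs⟩
      -- The derivation leaves the block here. The first node receives all of `O`, paid for by the
      -- local axioms used so far.
      · have hsub : L ⊆ (s.resolvent G, O) :: L := List.subset_cons_self _ _
        obtain ⟨L', h₁, h₂, h₃, h₄, h₅⟩ := exists_nodes_of_source ss (s.resolvent G)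
          ((s.resolvent G, O) :: L)
          ⟨supported_local_source hv.2.1 hs hG.inBlock hG.use hG.falseOff, hL⟩ (hA.mono hsub)
          (Or.inl ⟨_, List.mem_cons_self, rfl⟩) hv.2.2 hr.2
        refine ⟨L', List.Subset.trans hsub h₁, h₂, ?_, ?_, h₅.imp id Or.inl⟩
        · simp only [List.length_cons] at h₃ ⊢; omega
        · simp only [totalUse, List.map_cons, List.sum_cons, List.length_cons] at h₄ ⊢; omega
      · have hij : i = j := by
          have h₁ := hG.inBlock _ _ hv.2.1.1
          rw [hs.inBlock _ _ hv.2.1.2] at h₁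
          exact Option.some.inj h₁
        subst hij
        have hf' : Forcing i G ∨ w i 2 ∉ Clause.vars s.side :=
          hf.imp id fun h => h s List.mem_cons_self
        have hp := isInner_pivot hv.2.1 hs ht hf'
        obtain ⟨O', hO', hOj, hOf⟩ := exists_localUse hs
        have hG' : LocalClause i (O ∪ O') (s.resolvent G) := by
          refine ⟨ht, ?_, oneOfEachSign_resolvent hv.2.1 hs.oneOfEachSign hG.one hp, ?_, ?_⟩
          · intro v c hvc
            rcases mem_resolvent.1 hvc with h | h
            · exact hG.inBlock v c h.2
            · exact hs.inBlock v c h.2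
          · intro p hp
            exact (Finset.mem_union.1 hp).elim (hG.use p) (hOj p)
          · intro β h
            rcases pivot_cases ∅ β s with ⟨_, h', _⟩ | ⟨-, hp | hp⟩
            · exact h'.elim
            · exact (hOf β (falseOff_side h (Or.inr hp))).mono Finset.subset_union_right
            · exact (hG.falseOff β (falseOff_main h (Or.inr hp))).mono Finset.subset_union_left
        have hf'' : Forcing i (s.resolvent G) ∨ ∀ t ∈ ss, w i 2 ∉ Clause.vars t.side := by
          by_cases hp2 : s.pivot = w i 2
          -- Strong regularity enters: once `w i 2` is resolved away, no later side premise contains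
          -- it, hence none contains an outer variable.
          · exact Or.inr fun t ht => hp2 ▸ hr.1 _ (side_mem_stepsClauses ss _ t ht)
          · exact hf.imp (fun h => forcing_resolvent hs.forcing h hp2)
              fun h t ht => h t (List.mem_cons_of_mem _ ht)
        obtain ⟨L', h₁, h₂, h₃, h₄, h₅⟩ := exists_nodes_of_local ss (s.resolvent G) (O ∪ O') L hL
          hA hG' hf'' hv.2.2 hr.2
        have hc := Finset.card_union_le O O'
        refine ⟨L', h₁, h₂, by simp only [List.length_cons]; omega,
          by simp only [List.length_cons]; omega, h₅.imp id (Or.imp id fun h => ⟨h.1, ?_⟩)⟩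
        exact fun hm => hm.elim
          (not_isMerge hv.2.1 hs hG.one hG.notTaut hts hf' hp) h.2

theorem exists_nodes_of_derivation {ℓ m n : ℕ} {Ax : Set (Clause SepVar)} {L : List Node}
    (hL : Justified ℓ m n L) (hA : Classified ℓ m n L Ax) {d : InputDerivation SepVar}
    (hd : d.IsFrom Ax) (hr : d.StronglyRegular) :
    ∃ L', L ⊆ L' ∧ Justified ℓ m n L' ∧ L'.length ≤ L.length + d.length ∧
      totalUse L' ≤ totalUse L + d.length ∧
      (d.conclusion.Tautology ∨ Source ℓ m n L' d.conclusion ∨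
        d.conclusion ≠ ∅ ∧ ¬d.ContainsMerge) := by
  rw [length_eq]
  by_cases ht : d.start.Tautology
  · exact ⟨L, List.Subset.refl _, hL, by omega, by omega,
      Or.inl (tautology_conclusion _ _ hr ht)⟩
  rcases hA _ hd.1 ht with hs | ⟨j, hs⟩
  · obtain ⟨L', h₁, h₂, h₃, h₄, h₅⟩ := exists_nodes_of_source _ _ L hL hA hs hd.2 hr
    exact ⟨L', h₁, h₂, by omega, by omega, h₅.imp id Or.inl⟩
  · obtain ⟨O, hO, hOj, hOf⟩ := exists_localUse hs
    obtain ⟨L', h₁, h₂, h₃, h₄, h₅⟩ := exists_nodes_of_local _ _ O L hL hA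
      ⟨ht, hs.inBlock, hs.oneOfEachSign, hOj, hOf⟩ (Or.inl hs.forcing) hd.2 hr
    exact ⟨L', h₁, h₂, by omega, by omega, h₅⟩

/-- A derivation that stays local is excluded everywhere: before the end because it has no merge, at
the end because its conclusion is not empty. A tautological lemma needs no node, since `Classified`
ignores tautologies. -/
theorem exists_nodes_of_refutation {ℓ m n : ℕ} :
    ∀ (π : List (InputDerivation SepVar)) (Ax : Set (Clause SepVar)) (L : List Node),
      Justified ℓ m n L → Classified ℓ m n L Ax → InputStructured Ax π →
      (∀ d ∈ π.dropLast, d.ContainsMerge) → (∀ d ∈ π, d.StronglyRegular) →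
      EndsInEmptyClause π →
      ∃ L', Justified ℓ m n L' ∧ L'.length ≤ L.length + sequenceLength π ∧
        totalUse L' ≤ totalUse L + sequenceLength π ∧ Source ℓ m n L' ∅
  | [], _, _, _, _, _, _, _, h => by simp [EndsInEmptyClause] at h
  | [d], Ax, L, hL, hA, hI, _, hr, hE => by
      obtain ⟨L', -, h₂, h₃, h₄, h₅⟩ := exists_nodes_of_derivation hL hA hI.1 (hr d (by simp))
      have hd : d.conclusion = ∅ := by simpa [EndsInEmptyClause] using hE
      rw [hd] at h₅
      refine ⟨L', h₂, by simpa [sequenceLength] using h₃, by simpa [sequenceLength] using h₄, ?_⟩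
      rcases h₅ with ⟨_, _, h, _⟩ | h | h
      · simp at h
      · exact h
      · exact (h.1 rfl).elim
  | d :: e :: π, Ax, L, hL, hA, hI, hM, hr, hE => by
      obtain ⟨L', h₁, h₂, h₃, h₄, h₅⟩ := exists_nodes_of_derivation hL hA hI.1 (hr d (by simp))
      have hA' : Classified ℓ m n L' (insert d.conclusion Ax) := by
        rintro D (rfl | hD) ht
        · rcases h₅ with h | h | h
          · exact (ht h).elim
          · exact Or.inl h
          · exact (h.2 (hM d (by simp [List.dropLast]))).elim
        · exact hA.mono h₁ D hD ht
      obtain ⟨L'', k₂, k₃, k₄, k₅⟩ := exists_nodes_of_refutation (e :: π) _ L' h₂ hA' hI.2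
        (fun f hf => hM f (by simp only [List.dropLast]; exact List.mem_cons_of_mem _ hf))
        (fun f hf => hr f (List.mem_cons_of_mem _ hf))
        (by simpa [EndsInEmptyClause] using hE)
      refine ⟨L'', k₂, ?_, ?_, k₅⟩ <;>
      · simp only [sequenceLength, List.map_cons, List.sum_cons] at k₃ k₄ ⊢; omega

theorem classified_F₁ (ℓ m n : ℕ) :
    Classified ℓ m n [] (F₁ ℓ m n : Set (Clause SepVar)) := by
  intro D hD _
  simp only [F₁, F, Finset.mem_coe, Finset.mem_union, Finset.mem_biUnion] at hD
  rcases hD with (⟨j, hj, k, hk, hD⟩ | ⟨i, hi, hD⟩) | ⟨j, hj, hD⟩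
  · right
    simp only [Finset.mem_insert, Finset.mem_singleton] at hD
    exact ⟨j, Or.inl (hD.elim (fun h => ⟨k, true, (Finset.mem_Ico.1 hk).1, h⟩)
      fun h => ⟨k, false, (Finset.mem_Ico.1 hk).1, h⟩)⟩
  · left; right
    simp only [Finset.mem_insert, Finset.mem_singleton] at hD
    exact ⟨i, hi, hD.elim (⟨_, ·⟩) (⟨_, ·⟩)⟩
  · exact Or.inr ⟨j, Or.inr hD⟩

theorem exists_nodes {ℓ m n : ℕ} {π : List (InputDerivation SepVar)}
    (hπ : IsLRMARefutation (F₁ ℓ m n) π) :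
    ∃ L, Justified ℓ m n L ∧ L.length ≤ sequenceLength π ∧ totalUse L ≤ sequenceLength π ∧
      ∃ p ∈ L, p.1 = ∅ := by
  obtain ⟨⟨⟨hI, hM⟩, hr⟩, hE⟩ := hπ
  obtain ⟨L, h₁, h₂, h₃, h₄⟩ :=
    exists_nodes_of_refutation π _ [] trivial (classified_F₁ ℓ m n) hI hM hr hE
  refine ⟨L, h₁, by simpa using h₂, by simpa [totalUse] using h₃, ?_⟩
  rcases h₄ with h | ⟨i, -, b, h⟩
  · exact h
  · have : (w (blockOf ℓ i) 1, b) ∈ (∅ : Clause SepVar) := h ▸ by simp [clauseA]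
    simp at this

end SepFormula

namespace SepFormula

open SepVar

/-! ### Restrictions -/

section Restriction

open Classical in
/-- Greedy choice of a partial assignment: if every element of `𝒞` can be killed at many of the
indices, then few assigned indices suffice to kill most of `𝒞`. -/
theorem exists_greedy_restriction {ι : Type*} (q : ℕ) (𝒞 : Finset ι)
    (kill : ι → ℕ → Bool → Prop) (B : ι → Finset ℕ)
    (hB : ∀ c ∈ 𝒞, B c ⊆ Finset.Icc 1 (48 * q) ∧ 28 * q ≤ (B c).card ∧
      ∀ j ∈ B c, ∃ b, kill c j b) :
    ∀ r ≤ 14 * q, ∃ γ : ℕ → Option Bool,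
      ((Finset.Icc 1 (48 * q)).filter fun j => γ j ≠ none).card ≤ r ∧
      48 ^ r * (𝒞.filter fun c => ∀ j b, γ j = some b → ¬kill c j b).card ≤ 41 ^ r * 𝒞.card
  | 0, _ => ⟨fun _ => none, by simp, by simp⟩
  | r + 1, hr => by
      obtain ⟨γ, h₁, h₂⟩ := exists_greedy_restriction q 𝒞 kill B hB r (by omega)
      set 𝒮 := 𝒞.filter fun c => ∀ j b, γ j = some b → ¬kill c j b with h𝒮
      rcases 𝒮.eq_empty_or_nonempty with h0 | h0
      · exact ⟨γ, by omega, by rw [← h𝒮, h0]; simp⟩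
      set P := ((Finset.Icc 1 (48 * q)).filter fun j => γ j = none) ×ˢ (Finset.univ : Finset Bool)
      have hP : P.card ≤ 96 * q := by
        have : ((Finset.Icc 1 (48 * q)).filter fun j => γ j = none).card ≤ 48 * q :=
          (Finset.card_filter_le _ _).trans (by simp)
        rw [Finset.card_product, Finset.card_univ, Fintype.card_bool]
        omega
      have hdeg : ∀ c ∈ 𝒮, 14 * q ≤ (P.filter fun p => kill c p.1 p.2).card := by
        intro c hc
        obtain ⟨hB₁, hB₂, hB₃⟩ := hB c (Finset.mem_filter.1 hc).1
        have hsub : B c \ ((Finset.Icc 1 (48 * q)).filter fun j => γ j ≠ none) ⊆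
            (P.filter fun p => kill c p.1 p.2).image Prod.fst := by
          intro j hj
          obtain ⟨hj₁, hj₂⟩ := Finset.mem_sdiff.1 hj
          obtain ⟨b, hb⟩ := hB₃ j hj₁
          have hγ : γ j = none := by
            by_contra hne
            exact hj₂ (Finset.mem_filter.2 ⟨hB₁ hj₁, hne⟩)
          exact Finset.mem_image.2 ⟨(j, b), Finset.mem_filter.2 ⟨Finset.mem_product.2
            ⟨Finset.mem_filter.2 ⟨hB₁ hj₁, hγ⟩, Finset.mem_univ _⟩, hb⟩, rfl⟩
        have h₃ := (Finset.card_le_card hsub).trans Finset.card_image_le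
        have h₄ := Finset.le_card_sdiff ((Finset.Icc 1 (48 * q)).filter fun j => γ j ≠ none) (B c)
        omega
      -- Averaging: each surviving clause is killed by at least `28 * q - 14 * q` of at most `96 *
      -- q` free pairs, so some pair kills a fraction `14 / 96 = 7 / 48` of the survivors.
      obtain ⟨⟨j, b⟩, hjb, hk⟩ : ∃ p ∈ P, 7 * 𝒮.card ≤
          48 * (𝒮.filter fun c => kill c p.1 p.2).card := by
        by_contra! hcon
        have hsum : ∑ c ∈ 𝒮, (P.filter fun p => kill c p.1 p.2).card =
            ∑ p ∈ P, (𝒮.filter fun c => kill c p.1 p.2).card :=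
          Finset.sum_card_bipartiteAbove_eq_sum_card_bipartiteBelow
            (fun c (p : ℕ × Bool) => kill c p.1 p.2)
        have h₃ : 𝒮.card * (14 * q) ≤ ∑ c ∈ 𝒮, (P.filter fun p => kill c p.1 p.2).card := by
          simpa using Finset.card_nsmul_le_sum _ _ _ hdeg
        have hPne : P.Nonempty := by
          rw [← Finset.card_pos]
          obtain ⟨c, hc⟩ := h0
          have := (hdeg c hc).trans (Finset.card_filter_le _ _)
          omega
        have h₄ : ∑ p ∈ P, 48 * (𝒮.filter fun c => kill c p.1 p.2).card <
            P.card * (7 * 𝒮.card) := by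
          simpa using Finset.sum_lt_sum_of_nonempty hPne hcon
        rw [← Finset.mul_sum, ← hsum] at h₄
        have h₅ : P.card * (7 * 𝒮.card) ≤ 96 * q * (7 * 𝒮.card) := Nat.mul_le_mul_right _ hP
        nlinarith
      have hγj : γ j = none := (Finset.mem_filter.1 (Finset.mem_product.1 hjb).1).2
      refine ⟨Function.update γ j (some b), ?_, ?_⟩
      · have hsub : ((Finset.Icc 1 (48 * q)).filter fun i => Function.update γ j (some b) i ≠ none)
            ⊆ insert j ((Finset.Icc 1 (48 * q)).filter fun i => γ i ≠ none) := by
          intro i hi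
          obtain ⟨hi₁, hi₂⟩ := Finset.mem_filter.1 hi
          by_cases hij : i = j
          · exact Finset.mem_insert.2 (Or.inl hij)
          · rw [Function.update_of_ne hij] at hi₂
            exact Finset.mem_insert.2 (Or.inr (Finset.mem_filter.2 ⟨hi₁, hi₂⟩))
        exact (Finset.card_le_card hsub).trans ((Finset.card_insert_le _ _).trans (by omega))
      · have hsub : (𝒞.filter fun c => ∀ i b', Function.update γ j (some b) i = some b' →
            ¬kill c i b') ⊆ 𝒮.filter fun c => ¬kill c j b := by
          intro c hc
          obtain ⟨hc₁, hc₂⟩ := Finset.mem_filter.1 hc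
          refine Finset.mem_filter.2 ⟨Finset.mem_filter.2 ⟨hc₁, fun i b' hi => ?_⟩,
            hc₂ j b (by simp)⟩
          refine hc₂ i b' ?_
          rw [Function.update_of_ne, hi]
          rintro rfl
          simp [hγj] at hi
        have h₃ := Finset.card_le_card hsub
        have h₄ := Finset.card_filter_add_card_filter_not (s := 𝒮) fun c => kill c j b
        have h₅ : 48 * (𝒞.filter fun c => ∀ i b', Function.update γ j (some b) i = some b' →
            ¬kill c i b').card ≤ 41 * 𝒮.card := by
          simp only at hk
          omega
        calc 48 ^ (r + 1) * _ = 48 ^ r * (48 * _) := by rw [pow_succ, mul_assoc]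
          _ ≤ 48 ^ r * (41 * 𝒮.card) := Nat.mul_le_mul_left _ h₅
          _ = 41 * (48 ^ r * 𝒮.card) := by ring
          _ ≤ 41 * (41 ^ r * 𝒞.card) := Nat.mul_le_mul_left _ h₂
          _ = 41 ^ (r + 1) * 𝒞.card := by ring

end Restriction

/-- The value of a block variable if all variables `w` of the block have value `b`. -/
def blockValue (b : Bool) : SepVar → Bool
  | y _ => !b
  | _ => b

/-- Setting block `j` to `b` satisfies the clause. -/
def Kills (C : Clause SepVar) (j : ℕ) (b : Bool) : Prop :=
  ∃ v c, (v, c) ∈ C ∧ block? v = some j ∧ blockValue b v = c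

open Classical in
/-- The blocks among `1, …, ℓ` with a variable in `C`. -/
noncomputable def blocks (ℓ : ℕ) (C : Clause SepVar) : Finset ℕ :=
  (Finset.Icc 1 ℓ).filter fun j => ∃ v c, (v, c) ∈ C ∧ block? v = some j

theorem mem_blocks {ℓ j : ℕ} {C : Clause SepVar} :
    j ∈ blocks ℓ C ↔ j ∈ Finset.Icc 1 ℓ ∧ ∃ v c, (v, c) ∈ C ∧ block? v = some j := by
  simp only [blocks, Finset.mem_filter]

theorem exists_kills {ℓ j : ℕ} {C : Clause SepVar} (hj : j ∈ blocks ℓ C) : ∃ b, Kills C j b := by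
  obtain ⟨-, v, c, hv, hb⟩ := mem_blocks.1 hj
  cases v
  · cases hb
  · exact ⟨c, _, _, hv, hb, rfl⟩
  · exact ⟨!c, _, _, hv, hb, by simp [blockValue]⟩
  · exact ⟨c, _, _, hv, hb, rfl⟩

open Classical in
/-- A short list of clauses admits an assignment to few blocks that satisfies all clauses with
variables in many blocks. -/
theorem exists_restriction (q : ℕ) (L : List Node) (hL : L.length < 8 ^ q) :
    ∃ γ : ℕ → Option Bool,
      ((Finset.Icc 1 (48 * q)).filter fun j => γ j ≠ none).card ≤ 14 * q ∧
      ∀ p ∈ L, (∀ j b, γ j = some b → ¬Kills p.1 j b) → (blocks (48 * q) p.1).card < 28 * q := by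
  set 𝒞 := L.toFinset.filter fun p => 28 * q ≤ (blocks (48 * q) p.1).card
  obtain ⟨γ, h₁, h₂⟩ := exists_greedy_restriction q 𝒞 (fun p => Kills p.1)
    (fun p => blocks (48 * q) p.1) (fun p hp => ⟨Finset.filter_subset _ _,
      (Finset.mem_filter.1 hp).2, fun j hj => exists_kills hj⟩) (14 * q) le_rfl
  refine ⟨γ, h₁, fun p hp hk => ?_⟩
  by_contra! hcard
  have hpos : 1 ≤ (𝒞.filter fun p => ∀ j b, γ j = some b → ¬Kills p.1 j b).card :=
    Finset.card_pos.2 ⟨p, Finset.mem_filter.2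
      ⟨Finset.mem_filter.2 ⟨List.mem_toFinset.2 hp, hcard⟩, hk⟩⟩
  have h𝒞 : 𝒞.card < 8 ^ q :=
    ((Finset.card_filter_le _ _).trans (List.toFinset_card_le L)).trans_lt hL
  have h₃ : 41 ^ (14 * q) * 𝒞.card < 41 ^ (14 * q) * 8 ^ q :=
    Nat.mul_lt_mul_of_pos_left h𝒞 (by positivity)
  -- This is the `q`-th power of `41 ^ 14 * 8 ≤ 48 ^ 14`, so fewer than one clause survives `14 * q`
  -- rounds.
  have h₄ : 41 ^ (14 * q) * 8 ^ q ≤ 48 ^ (14 * q) := by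
    rw [pow_mul, pow_mul, ← mul_pow]
    exact Nat.pow_le_pow_left (by norm_num) q
  have h₅ := Nat.mul_le_mul_left (48 ^ (14 * q)) hpos
  omega

/-! ### Critical assignments -/

/-- The assignment with value `γ` on the blocks (`true` if undefined), where exactly the `x i`
with `i < t` are true. -/
def assign (γ : ℕ → Option Bool) (t : ℕ) : SepVar → Bool
  | x i => decide (i < t)
  | w j _ => (γ j).getD true
  | y j => !(γ j).getD true
  | z j => (γ j).getD true

/-- As `assign`, but in block `j` exactly the `w j k` with `k ≤ s` are true. -/
def cutAssign (γ : ℕ → Option Bool) (j s t : ℕ) : SepVar → Bool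
  | x i => decide (i < t)
  | w i k => if i = j then decide (k ≤ s) else (γ i).getD true
  | y i => if i = j then false else !(γ i).getD true
  | z i => if i = j then true else (γ i).getD true

/-- The literals of `C` on the variables `x` are falsified if exactly the `x i` with `i < t` are
true. -/
def XFalse (t : ℕ) (C : Clause SepVar) : Prop := ∀ i c, (x i, c) ∈ C → decide (i < t) = !c

theorem xFalse_of_falseOff_cutAssign {S : Set ℕ} {γ : ℕ → Option Bool} {j s t : ℕ}
    {C : Clause SepVar} (h : FalseOff S (cutAssign γ j s t) C) : XFalse t C :=
  fun i c hi => h (x i) c hi fun _ _ h' => nomatch h'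

theorem xFalse_of_falseOff_assign {S : Set ℕ} {γ : ℕ → Option Bool} {t : ℕ}
    {C : Clause SepVar} (h : FalseOff S (assign γ t) C) : XFalse t C :=
  fun i c hi => h (x i) c hi fun _ _ h' => nomatch h'

theorem xFalse_between {t₁ t t₂ : ℕ} {C : Clause SepVar} (h₁ : t₁ ≤ t) (h₂ : t ≤ t₂)
    (hC₁ : XFalse t₁ C) (hC₂ : XFalse t₂ C) : XFalse t C := by
  intro i c hi
  have a₁ := hC₁ i c hi
  have a₂ := hC₂ i c hi
  cases c <;> simp at a₁ a₂ ⊢ <;> omega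

/-- The literals `¬x (i - 1)` and `x i` are both false only when the switch from true to false
happens at `i`. For the omitted constants the range of `t` takes over. -/
theorem eq_of_xFalse_clauseA {ℓ m n i t : ℕ} {b : Bool} (hi : i ∈ Finset.Icc 1 (m * ℓ))
    (ht : t ∈ Finset.Icc 1 (m * ℓ)) (h : XFalse t (clauseA ℓ m n i b)) : i = t := by
  rw [Finset.mem_Icc] at hi ht
  have h₁ : i ≠ 1 → i - 1 < t := fun hne => by
    simpa using h (i - 1) false (by simp [clauseA, clauseX, hne])
  have h₂ : i ≠ m * ℓ → t ≤ i := fun hne => by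
    simpa using h i true (by simp [clauseA, clauseX, hne])
  omega

/-- All blocks but `j` are constant and satisfy their axioms. In block `j` the values of `w` change
only after `s`. As `2 ≤ s`, both `w j 1` and `w j 2` are true, so `y j` false and `z j` true satisfy
the extra clauses. -/
theorem locallyFalse_cutAssign {γ : ℕ → Option Bool} {j s t i : ℕ} (hs : 2 ≤ s)
    {O : Finset (ℕ × ℕ)} (h : LocallyFalse i (cutAssign γ j s t) O) : (j, s) ∈ O := by
  rcases h with ⟨k, b, hk, hf⟩ | ⟨D, hD, hf⟩
  · have h₁ := hf (w i k) b (by simp [clauseB]) (by simp)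
    have h₂ := hf (w i (k + 1)) (!b) (by simp [clauseB]) (by simp)
    clear hf
    simp only [cutAssign] at h₁ h₂
    split_ifs at h₁ h₂ with hij
    · have : k = s := by cases b <;> simp at h₁ h₂ <;> omega
      rwa [← hij, ← this]
    · rw [h₁] at h₂; cases b <;> simp at h₂
  · exfalso
    have hs1 : 1 ≤ s := by omega
    simp only [extra, Finset.mem_insert, Finset.mem_singleton] at hD
    rcases hD with rfl | rfl | rfl | rfl
    · have h₁ := hf (w i 1) false (by simp) (by simp)
      have h₂ := hf (w i 2) true (by simp) (by simp)
      simp only [cutAssign] at h₁ h₂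
      split_ifs at h₁ h₂ <;> grind
    · have h₁ := hf (w i 2) false (by simp) (by simp)
      have h₂ := hf (z i) true (by simp) (by simp)
      simp only [cutAssign] at h₁ h₂
      split_ifs at h₁ h₂ <;> grind
    · have h₁ := hf (w i 1) true (by simp) (by simp)
      have h₂ := hf (w i 2) false (by simp) (by simp)
      simp only [cutAssign] at h₁ h₂
      split_ifs at h₁ h₂ <;> grind
    · have h₁ := hf (w i 2) true (by simp) (by simp)
      have h₂ := hf (y i) true (by simp) (by simp)
      simp only [cutAssign] at h₁ h₂
      split_ifs at h₁ h₂ <;> grind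

/-! ### Tracing falsified clauses to nodes that use a given axiom -/

/-- Tracing falsified clauses back leads to a node using a falsified clause `clauseB`. -/
theorem exists_use {ℓ m n j s : ℕ} {S : Set ℕ} {β : SepVar → Bool}
    (hA : ∀ i ∈ Finset.Icc 1 (m * ℓ), ∀ b, ¬FalseOff S β (clauseA ℓ m n i b))
    (hB : ∀ i ∉ S, ∀ O, LocallyFalse i β O → (j, s) ∈ O) :
    ∀ L : List Node, Justified ℓ m n L → (∃ p ∈ L, FalseOff S β p.1) →
      ∃ p ∈ L, FalseOff S β p.1 ∧ (j, s) ∈ p.2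
  | [], _, h => by simp at h
  | p :: L, hL, h => by
      have tail : (∃ q ∈ L, FalseOff S β q.1) → ∃ q ∈ p :: L, FalseOff S β q.1 ∧ (j, s) ∈ q.2 :=
        fun h => by
          obtain ⟨q, hq, h⟩ := exists_use hA hB L hL.2 h
          exact ⟨q, List.mem_cons_of_mem _ hq, h⟩
      obtain ⟨q, hq, hf⟩ := h
      rcases List.mem_cons.1 hq with rfl | hq
      · rcases hL.1.falseOff S β hf with ⟨D, ⟨r, hr, rfl⟩ | ⟨i, hi, b, rfl⟩, hD⟩ | ⟨i, hi, hO⟩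
        · exact tail ⟨r, hr, hD⟩
        · exact (hA i hi b hD).elim
        · exact ⟨q, List.mem_cons_self, hf, hB i hi _ hO⟩
      · exact tail ⟨q, hq, hf⟩

/-- The clause is falsified, outside the blocks without value, for all `t` in the interval
`(a * ℓ, a * ℓ + ℓ]`. -/
def Wide (ℓ a : ℕ) (γ : ℕ → Option Bool) (C : Clause SepVar) : Prop :=
  ∀ t, a * ℓ < t → t ≤ a * ℓ + ℓ → FalseOff {j | γ j = none} (assign γ t) C

/-- The node covers the position `a * ℓ + j` but not all of the interval `(a * ℓ, a * ℓ + ℓ]`. -/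
def Covers (ℓ a j : ℕ) (p : Node) : Prop :=
  XFalse (a * ℓ + j) p.1 ∧ ¬∀ t, a * ℓ < t → t ≤ a * ℓ + ℓ → XFalse t p.1

/-- The `x`-part of `clauseA` is false at a single position, whereas the interval contains at least
two. -/
theorem not_wide_clauseA {ℓ m n a i : ℕ} {γ : ℕ → Option Bool} {b : Bool} (hℓ : 2 ≤ ℓ)
    (ha : a < m) (hi : i ∈ Finset.Icc 1 (m * ℓ)) : ¬Wide ℓ a γ (clauseA ℓ m n i b) := by
  intro h
  have hm : a * ℓ + ℓ ≤ m * ℓ := by nlinarith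
  have h₁ := eq_of_xFalse_clauseA hi (Finset.mem_Icc.2 ⟨by omega, by omega⟩)
    (xFalse_of_falseOff_assign (h (a * ℓ + 1) (by omega) (by omega)))
  have h₂ := eq_of_xFalse_clauseA hi (Finset.mem_Icc.2 ⟨by omega, by omega⟩)
    (xFalse_of_falseOff_assign (h (a * ℓ + 2) (by omega) (by omega)))
  omega

theorem cutAssign_eq_assign {γ : ℕ → Option Bool} {j s t t' : ℕ} {v : SepVar}
    (hv : block? v ≠ some j) (hx : ∀ i, v = x i → t' = t) :
    cutAssign γ j s t v = assign γ t' v := by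
  cases v with
  | x i => rw [hx i rfl]; rfl
  | w i k => simp [cutAssign, assign, show i ≠ j from fun h => hv (h ▸ rfl)]
  | y i => simp [cutAssign, assign, show i ≠ j from fun h => hv (h ▸ rfl)]
  | z i => simp [cutAssign, assign, show i ≠ j from fun h => hv (h ▸ rfl)]

/-- If `(C, O)` is the first wide node and `j` is a block without value that does not occur
in `C`, then all clauses `clauseB j s _` are used for nodes covering the position of block `j`. -/
theorem exists_covers {ℓ m n a j s : ℕ} {γ : ℕ → Option Bool} {p : Node} {L : List Node}
    (hℓ : 2 ≤ ℓ) (ha : a < m) (hL : Justified ℓ m n (p :: L)) (hp : Wide ℓ a γ p.1)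
    (hmin : ∀ q ∈ L, ¬Wide ℓ a γ q.1) (hj : j ∈ Finset.Icc 1 ℓ) (hγ : γ j = none)
    (hjp : j ∉ blocks ℓ p.1) (hs : 2 ≤ s) (hsn : s < n) :
    ∃ q ∈ p :: L, (j, s) ∈ q.2 ∧ Covers ℓ a j q := by
  have hj' := Finset.mem_Icc.1 hj
  have hm : a * ℓ + ℓ ≤ m * ℓ := by nlinarith
  set t := a * ℓ + j with ht
  -- Block `j` is the one unassigned block that is not disregarded; it is evaluated by the cut.
  set S : Set ℕ := {i | γ i = none ∧ i ≠ j} with hS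
  have hjS : j ∉ S := fun h => h.2 rfl
  have hA : ∀ i ∈ Finset.Icc 1 (m * ℓ), ∀ b,
      ¬FalseOff S (cutAssign γ j s t) (clauseA ℓ m n i b) := by
    intro i hi b hf
    have hit := eq_of_xFalse_clauseA hi (Finset.mem_Icc.2 ⟨by omega, by omega⟩)
      (xFalse_of_falseOff_cutAssign hf)
    have hbl : blockOf ℓ i = j := by
      rw [hit, ht, blockOf, show a * ℓ + j - 1 = (j - 1) + a * ℓ by omega, Nat.add_mul_mod_self_right,
        Nat.mod_eq_of_lt (by omega)]
      omega
    have hnS : ∀ k, ∀ i ∈ S, block? (w j k) ≠ some i := by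
      intro k i hi h
      cases h
      exact hjS hi
    -- Only the axioms at position `t` could be false, and their block is `j`. There `w j 1` is true
    -- and `w j n` is false because `1 ≤ s < n`, which satisfies both of them.
    have h₁ := hf (w j 1) b (by simp [clauseA, hbl]) (hnS 1)
    have h₂ := hf (w j n) b (by simp [clauseA, hbl]) (hnS n)
    clear hf
    have hs1 : 1 ≤ s := by omega
    simp only [cutAssign, if_true] at h₁ h₂
    cases b <;> simp at h₁ h₂ <;> omega
  have hfp : FalseOff S (cutAssign γ j s t) p.1 := by
    intro v c hv hvS
    have hvj : block? v ≠ some j := fun h =>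
      hjp (mem_blocks.2 ⟨hj, v, c, hv, h⟩)
    rw [cutAssign_eq_assign (t' := t) hvj fun _ _ => rfl]
    refine hp t (by omega) (by omega) v c hv fun i hi h => ?_
    exact hvS i ⟨hi, fun hij => hvj (hij ▸ h)⟩ h
  obtain ⟨q, hq, hfq, hu⟩ := exists_use hA
    (fun i _ O h => locallyFalse_cutAssign hs h) (p :: L) hL ⟨p, List.mem_cons_self, hfp⟩
  refine ⟨q, hq, hu, xFalse_of_falseOff_cutAssign hfq, fun hall => ?_⟩
  rcases List.mem_cons.1 hq with rfl | hq
  -- If the first wide node itself used the axiom, its source would lie inside its clause up to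
  -- literals of the unassigned block `j`. That source would then be wide too.
  · obtain ⟨D, hD, hsub⟩ := hL.1.subset _ hu
    have hw : Wide ℓ a γ D := fun t h₁ h₂ v c hv hvS =>
      hp t h₁ h₂ v c (hsub v c hv (hvS j hγ)) hvS
    rcases hD with ⟨r, hr, rfl⟩ | ⟨i, hi, b, rfl⟩
    · exact hmin r hr hw
    · exact not_wide_clauseA hℓ ha hi hw
  -- The cut differs from `assign` only on block `j`, which `Wide` disregards. An earlier node false
  -- on the whole interval would therefore be wide.
  · refine hmin q hq fun t' h₁ h₂ v c hv hvS => ?_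
    by_cases hx : ∃ i, v = x i
    · obtain ⟨i, rfl⟩ := hx
      exact hall t' h₁ h₂ i c hv
    · rw [← cutAssign_eq_assign (j := j) (s := s) (t := t) (hvS j hγ) fun i hi => (hx ⟨i, hi⟩).elim]
      exact hfq v c hv fun i hi => hvS i hi.1

theorem exists_first {α : Type*} (P : α → Prop) : ∀ L : List α, (∃ p ∈ L, P p) →
    ∃ L₁ p L₂, L = L₁ ++ p :: L₂ ∧ P p ∧ ∀ q ∈ L₂, ¬P q
  | [], h => by simp at h
  | p :: L, h => by
      by_cases hL : ∃ q ∈ L, P q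
      · obtain ⟨L₁, q, L₂, rfl, hq⟩ := exists_first P L hL
        exact ⟨p :: L₁, q, L₂, rfl, hq⟩
      · obtain ⟨q, hq, hPq⟩ := h
        rcases List.mem_cons.1 hq with rfl | hq
        · exact ⟨[], q, L, rfl, hPq, fun r hr h => hL ⟨r, hr, h⟩⟩
        · exact (hL ⟨q, hq, hPq⟩).elim

/-! ### Counting the uses -/

theorem justified_of_append {ℓ m n : ℕ} :
    ∀ {L₁ L₂ : List Node}, Justified ℓ m n (L₁ ++ L₂) → Justified ℓ m n L₂
  | [], _, h => h
  | _ :: _, _, h => justified_of_append h.2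

open Classical in
theorem le_card_covered {m n q a : ℕ} {L : List Node} (hq : 0 < q) (ha : a < m)
    (hL : Justified (48 * q) m n L) (hlen : L.length < 8 ^ q) (hE : ∃ p ∈ L, p.1 = ∅) :
    6 * q ≤ ((Finset.Icc 1 (48 * q)).filter fun j => ∀ s, 2 ≤ s → s < n →
      ∃ p ∈ L, (j, s) ∈ p.2 ∧ Covers (48 * q) a j p).card := by
  obtain ⟨γ, hγ, hbl⟩ := exists_restriction q L hlen
  obtain ⟨L₁, p, L₂, rfl, hp, hmin⟩ := exists_first (fun p : Node => Wide (48 * q) a γ p.1) L <| by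
    obtain ⟨p, hp, h⟩ := hE
    exact ⟨p, hp, fun t _ _ v c hv => by simp [h] at hv⟩
  -- The literals of a wide clause in assigned blocks are false under `γ`, so the restriction did
  -- not kill it and it touches fewer than `28 * q` blocks.
  have hnk : ∀ j b, γ j = some b → ¬Kills p.1 j b := by
    rintro j b hj ⟨v, c, hv, hvj, hc⟩
    have := hp (a * (48 * q) + 1) (by omega) (by omega) v c hv fun i hi h => by
      rw [hvj] at h
      cases h
      simp [hj] at hi
    have hval : assign γ (a * (48 * q) + 1) v = blockValue b v := by
      cases v with
      | x i => cases hvj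
      | _ => cases hvj; simp [assign, blockValue, hj]
    rw [hval, hc] at this
    cases c <;> simp at this
  have hpb := hbl p (by simp) hnk
  -- The unassigned blocks absent from `p.1` number at least `48 * q - 14 * q - 28 * q = 6 * q`.
  have hsub : Finset.Icc 1 (48 * q) \ (((Finset.Icc 1 (48 * q)).filter fun j => γ j ≠ none) ∪
      blocks (48 * q) p.1) ⊆ (Finset.Icc 1 (48 * q)).filter fun j => ∀ s, 2 ≤ s → s < n →
        ∃ p' ∈ L₁ ++ p :: L₂, (j, s) ∈ p'.2 ∧ Covers (48 * q) a j p' := by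
    intro j hj
    simp only [Finset.mem_sdiff, Finset.mem_union, Finset.mem_filter, not_or, not_and,
      not_not] at hj
    obtain ⟨hj, hjγ, hjp⟩ := hj
    refine Finset.mem_filter.2 ⟨hj, fun s hs hsn => ?_⟩
    obtain ⟨r, hr, h⟩ := exists_covers (by omega) ha (justified_of_append hL) hp hmin hj (hjγ hj)
      hjp hs hsn
    exact ⟨r, List.mem_append_right _ hr, h⟩
  have h₁ := Finset.card_le_card hsub
  have h₂ := Finset.le_card_sdiff (((Finset.Icc 1 (48 * q)).filter fun j => γ j ≠ none) ∪
      blocks (48 * q) p.1) (Finset.Icc 1 (48 * q))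
  have h₃ := Finset.card_union_le ((Finset.Icc 1 (48 * q)).filter fun j => γ j ≠ none)
    (blocks (48 * q) p.1)
  rw [Nat.card_Icc] at h₂
  omega

open Classical in
/-- A node covers the position of block `j` in at most two intervals partially. -/
theorem card_covers_le_two (ℓ m j : ℕ) (hj : j ∈ Finset.Icc 1 ℓ) (p : Node) :
    ((Finset.range m).filter fun a => Covers ℓ a j p).card ≤ 2 := by
  by_contra! h
  obtain ⟨a, ha, b, hb, c, hc, hab, hac, hbc⟩ := Finset.two_lt_card.1 h
  have key : ∀ a b c, a < b → b < c → Covers ℓ a j p → Covers ℓ b j p → Covers ℓ c j p →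
      False := by
    intro a b c hab hbc ha hb hc
    have hj' := Finset.mem_Icc.1 hj
    have h₁ : a * ℓ + ℓ ≤ b * ℓ := by nlinarith
    have h₂ : b * ℓ + ℓ ≤ c * ℓ := by nlinarith
    -- False at positions in the outer intervals, the clause is false throughout the middle one by
    -- convexity.
    exact hb.2 fun t h₃ h₄ => xFalse_between (by omega) (by omega) ha.1 hc.1
  replace ha := (Finset.mem_filter.1 ha).2
  replace hb := (Finset.mem_filter.1 hb).2
  replace hc := (Finset.mem_filter.1 hc).2
  rcases lt_or_gt_of_ne hab with h₁ | h₁ <;> rcases lt_or_gt_of_ne hac with h₂ | h₂ <;>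
    rcases lt_or_gt_of_ne hbc with h₃ | h₃
  · exact key _ _ _ h₁ h₃ ha hb hc
  · exact key _ _ _ h₂ h₃ ha hc hb
  · omega
  · exact key _ _ _ h₂ h₁ hc ha hb
  · exact key _ _ _ h₁ h₂ hb ha hc
  · omega
  · exact key _ _ _ h₃ h₂ hb hc ha
  · exact key _ _ _ h₃ h₁ hc hb ha

theorem sum_toFinset_le_totalUse [DecidableEq Node] (L : List Node) :
    ∑ p ∈ L.toFinset, p.2.card ≤ totalUse L := by
  induction L with
  | nil => simp [totalUse]
  | cons p L ih =>
    rw [List.toFinset_cons]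
    simp only [totalUse, List.map_cons, List.sum_cons] at ih ⊢
    by_cases hp : p ∈ L.toFinset
    · rw [Finset.insert_eq_of_mem hp]
      omega
    · rw [Finset.sum_insert hp]
      omega

open Classical in
theorem le_totalUse {m n q : ℕ} {L : List Node} (hq : 0 < q)
    (hL : Justified (48 * q) m n L) (hlen : L.length < 8 ^ q) (hE : ∃ p ∈ L, p.1 = ∅) :
    m * (6 * q * (n - 2)) ≤ 2 * totalUse L := by
  set U : Finset (ℕ × ℕ × ℕ) := (Finset.range m).biUnion fun a =>
    (((Finset.Icc 1 (48 * q)).filter fun j => ∀ s, 2 ≤ s → s < n →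
      ∃ p ∈ L, (j, s) ∈ p.2 ∧ Covers (48 * q) a j p) ×ˢ Finset.Ico 2 n).image (Prod.mk a) with hU
  have h₁ : m * (6 * q * (n - 2)) ≤ U.card := by
    rw [hU, Finset.card_biUnion]
    · rw [← Finset.card_range m, ← smul_eq_mul, Finset.card_range]
      nth_rewrite 1 [← Finset.card_range m]
      refine Finset.card_nsmul_le_sum _ _ _ fun a ha => ?_
      rw [Finset.card_image_of_injective _ (Prod.mk_right_injective a), Finset.card_product,
        Nat.card_Ico]
      exact Nat.mul_le_mul_right _ (le_card_covered hq (Finset.mem_range.1 ha) hL hlen hE)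
    · intro a _ b _ hab
      refine Finset.disjoint_left.2 fun u hu hu' => hab ?_
      obtain ⟨_, _, rfl⟩ := Finset.mem_image.1 hu
      obtain ⟨_, _, h⟩ := Finset.mem_image.1 hu'
      exact (Prod.mk.inj h).1.symm
  -- Each triple `(a, j, s)` is charged to a use `(j, s)` at some node, and each use is charged by
  -- at most two values of `a`.
  have h₂ : U ⊆ L.toFinset.biUnion fun p => p.2.biUnion fun u =>
      ((Finset.range m).filter fun a => u.1 ∈ Finset.Icc 1 (48 * q) ∧
        Covers (48 * q) a u.1 p).image fun a => (a, u) := by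
    intro u hu
    obtain ⟨a, ha, hu⟩ := Finset.mem_biUnion.1 hu
    obtain ⟨⟨j, s⟩, hjs, rfl⟩ := Finset.mem_image.1 hu
    obtain ⟨hj, hs⟩ := Finset.mem_product.1 hjs
    obtain ⟨hj, h⟩ := Finset.mem_filter.1 hj
    obtain ⟨hs₁, hs₂⟩ := Finset.mem_Ico.1 hs
    obtain ⟨p, hp, hup, hcov⟩ := h s hs₁ hs₂
    exact Finset.mem_biUnion.2 ⟨p, List.mem_toFinset.2 hp, Finset.mem_biUnion.2 ⟨(j, s), hup,
      Finset.mem_image.2 ⟨a, Finset.mem_filter.2 ⟨ha, hj, hcov⟩, rfl⟩⟩⟩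
  have h₃ : U.card ≤ ∑ p ∈ L.toFinset, p.2.card * 2 := by
    refine (Finset.card_le_card h₂).trans (Finset.card_biUnion_le.trans
      (Finset.sum_le_sum fun p _ => Finset.card_biUnion_le_card_mul _ _ 2 fun u _ => ?_))
    refine Finset.card_image_le.trans ?_
    by_cases hu : u.1 ∈ Finset.Icc 1 (48 * q)
    · simpa [hu] using card_covers_le_two (48 * q) m u.1 hu p
    · simp only [hu, false_and, Finset.filter_false, Finset.card_empty, zero_le]
  rw [← Finset.sum_mul] at h₃
  have h₄ := sum_toFinset_le_totalUse L
  omega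

theorem le_sequenceLength {m n q : ℕ} (hq : 0 < q) {π : List (InputDerivation SepVar)}
    (hπ : IsLRMARefutation (F₁ (48 * q) m n) π) :
    8 ^ q ≤ sequenceLength π ∨ m * (6 * q * (n - 2)) ≤ 2 * sequenceLength π := by
  obtain ⟨L, h₁, h₂, h₃, h₄⟩ := exists_nodes hπ
  by_cases h : 8 ^ q ≤ sequenceLength π
  · exact Or.inl h
  · right
    have := le_totalUse hq h₁ (by omega) h₄
    omega

end SepFormula

/-! ### Numerical estimates and the final theorem -/

theorem log_le_clog (n : ℕ) (hn : 1 ≤ n) : Real.log n ≤ Nat.clog 2 n := by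
  have h : (n : ℝ) ≤ 2 ^ Nat.clog 2 n := by
    exact_mod_cast Nat.le_pow_clog (by norm_num) n
  have h₁ := Real.log_le_log (by exact_mod_cast hn) h
  rw [Real.log_pow] at h₁
  nlinarith [Real.log_two_lt_d9, (Nat.cast_nonneg (Nat.clog 2 n) : (0 : ℝ) ≤ _)]

theorem one_le_log {n : ℕ} (hn : 3 ≤ n) : 1 ≤ Real.log n := by
  rw [Real.le_log_iff_exp_le (by positivity)]
  have : (3 : ℝ) ≤ n := by exact_mod_cast hn
  linarith [Real.exp_one_lt_d9]

theorem clog_le_three_mul_log {n : ℕ} (hn : 3 ≤ n) : (Nat.clog 2 n : ℝ) ≤ 3 * Real.log n := by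
  have h : (2 : ℝ) ^ (Nat.clog 2 n).pred ≤ n := by
    exact_mod_cast (Nat.pow_pred_clog_lt_self (b := 2) (by norm_num) (by omega)).le
  have h₁ := Real.log_le_log (by positivity) h
  rw [Real.log_pow] at h₁
  have hpos : 0 < Nat.clog 2 n := Nat.clog_pos (by norm_num) (by omega)
  have h₂ : ((Nat.clog 2 n).pred : ℝ) = Nat.clog 2 n - 1 := by
    rw [Nat.pred_eq_sub_one, Nat.cast_sub hpos, Nat.cast_one]
  rw [h₂] at h₁
  have h₃ : (1 : ℝ) ≤ Nat.clog 2 n := by exact_mod_cast hpos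
  nlinarith [Real.log_two_gt_d9, one_le_log hn]

theorem mainTheorem4 :
    (∃ C : ℝ, 0 < C ∧ ∀ᶠ n : ℕ in Filter.atTop,
      ((CNF.vars (SepFormula.family n)).card : ℝ) ≤ C * (n * Real.log n) ∧
      ((SepFormula.family n).card : ℝ) ≤ C * (n * Real.log n) ∧
      ∃ π : List (InputDerivation SepVar), IsRMARefutation (SepFormula.family n) π ∧
        (sequenceLength π : ℝ) ≤ C * (n * Real.log n)) ∧
    (∃ c : ℝ, 0 < c ∧ ∀ᶠ n : ℕ in Filter.atTop,
      ∀ π : List (InputDerivation SepVar), IsLRMARefutation (SepFormula.family n) π →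
        c * ((n : ℝ) ^ 2 * Real.log n) ≤ (sequenceLength π : ℝ)) := by
  -- The refutation bound with `ℓ = 48 * Nat.clog 2 n` is at most `(14 * 48 + 96) * n * Nat.clog 2
  -- n`, which gives `768`; the factor `3` comes from `clog_le_three_mul_log`. The lower constant
  -- `1` works because `n ≤ 3 * (n - 2)`.
  refine ⟨⟨2304, by norm_num, ?_⟩, 1, by norm_num, ?_⟩
  · filter_upwards [Filter.eventually_ge_atTop 3] with n hn
    have hpos : 0 < Nat.clog 2 n := Nat.clog_pos (by norm_num) (by omega)
    have hlog := clog_le_three_mul_log hn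
    have bound : ∀ k : ℕ, k ≤ 768 * (n * Nat.clog 2 n) → (k : ℝ) ≤ 2304 * (n * Real.log n) := by
      intro k hk
      have h₁ : (k : ℝ) ≤ 768 * (n * Nat.clog 2 n) := by exact_mod_cast hk
      have h₂ : (n : ℝ) * Nat.clog 2 n ≤ n * (3 * Real.log n) :=
        mul_le_mul_of_nonneg_left hlog (Nat.cast_nonneg n)
      linarith
    have hle : Nat.clog 2 n ≤ n * Nat.clog 2 n := Nat.le_mul_of_pos_left _ (by omega)
    refine ⟨bound _ ?_, bound _ ?_, SepFormula.refutation (48 * Nat.clog 2 n) n n,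
      SepFormula.isRMARefutation_refutation (by omega) (by omega) (by omega), bound _ ?_⟩
    · refine (SepFormula.card_vars_F₁_le (by omega) (by omega)).trans ?_
      nlinarith
    · refine (SepFormula.card_F₁_le _ _ _).trans ?_
      nlinarith
    · refine (SepFormula.sequenceLength_refutation_le (by omega) (by omega) (by omega)).trans ?_
      nlinarith
  · filter_upwards [Filter.eventually_ge_atTop 4] with n hn π hπ
    have hpos : 0 < Nat.clog 2 n := Nat.clog_pos (by norm_num) (by omega)
    have hn' : (4 : ℝ) ≤ n := by exact_mod_cast hn
    rw [one_mul]
    rcases SepFormula.le_sequenceLength hpos hπ with h | h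
    -- A refutation too long for the restriction argument already has length at least `n ^ 3`.
    · have h₁ : n ^ 3 ≤ 8 ^ Nat.clog 2 n := by
        rw [show 8 = 2 ^ 3 by norm_num, ← pow_mul, mul_comm, pow_mul]
        exact Nat.pow_le_pow_left (Nat.le_pow_clog (by norm_num) n) 3
      have h₂ : ((n : ℝ) ^ 3) ≤ sequenceLength π := by exact_mod_cast h₁.trans h
      have h₃ : Real.log n ≤ n := Real.log_le_self (by linarith)
      calc (n : ℝ) ^ 2 * Real.log n ≤ n ^ 2 * n := by gcongr
        _ = (n : ℝ) ^ 3 := by ring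
        _ ≤ _ := h₂
    · have h₁ : (n : ℝ) * (6 * Nat.clog 2 n * (n - 2)) ≤ 2 * sequenceLength π := by
        have : ((n - 2 : ℕ) : ℝ) = n - 2 := by rw [Nat.cast_sub (by omega)]; norm_num
        rw [← this]
        exact_mod_cast h
      have h₂ := log_le_clog n (by omega)
      have h₃ : (n : ℝ) ^ 2 * Real.log n ≤ n ^ 2 * Nat.clog 2 n := by gcongr
      have h₄ : (0 : ℝ) ≤ n * Nat.clog 2 n := by positivity
      nlinarith
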